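/- All graphs are finite and simple. A clique of a graph $H$ is an inclusion-maximal set of pairwise adjacent vertices. The clique graph $K(H)$ is the intersection graph of the cliques of $H$: its vertices are the cliques of $H$, two distinct ones being adjacent when they share a vertex. Put $K^0(H)=H$ and $K^{n+1}(H)=K(K^n(H))$. The graph $H$ is convergent if the sequence $(K^n(H))_{n\ge 0}$ contains only finitely many graphs up to isomorphism, and divergent otherwise. The graph $H$ is (clique-)Helly if every nonempty family of cliques of $H$ whose members pairwise intersect has nonempty total intersection. Write $C_n$ for the cycle on $n$ vertices, $\cup$ for disjoint union, and $\overline{G}$ for the complement of $G$. Then: 1. for every $2$-regular graph $G$, the complement $\overline{G}$ is convergent if and only if $\overline{G}$ is Helly; 2. the graphs $\overline{C_3\cup C_3}$, $\overline{C_3\cup C_4}$ and $\overline{C_4\cup C_4}$ are Helly; 3. the graphs $\overline{C_8}$ and $\overline{C_3\cup C_5}$ are divergent. -/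

import Mathlib

universe u

namespace CliqueBehavior

/-- A clique is a maximal complete set of vertices (Mathlib's `IsClique` is a complete set). -/
def IsMaxClique {V : Type u} (G : SimpleGraph V) (s : Set V) : Prop :=
  Maximal G.IsClique s

/-- The clique graph `K(G)`: the intersection graph of the cliques of `G`. -/
def cliqueGraph {V : Type u} (G : SimpleGraph V) :
    SimpleGraph {s : Set V // IsMaxClique G s} where
  Adj a b := a ≠ b ∧ ((a : Set V) ∩ (b : Set V)).Nonempty
  symm := ⟨fun a b h => ⟨h.1.symm, by rw [Set.inter_comm]; exact h.2⟩⟩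
  loopless := ⟨fun _ h => h.1 rfl⟩

/-- A graph bundled with its vertex type. -/
structure Graph : Type (u + 1) where
  Vert : Type u
  graph : SimpleGraph Vert

/-- The iterated clique graphs: `K⁰(G) = G` and `Kⁿ⁺¹(G) = K(Kⁿ(G))`. -/
def iterCliqueGraph {V : Type u} (G : SimpleGraph V) : ℕ → Graph.{u}
  | 0 => ⟨V, G⟩
  | n + 1 => ⟨_, cliqueGraph (iterCliqueGraph G n).graph⟩

/-- `G` is convergent if the sequence `Kⁿ(G)` has, up to isomorphism, finitely many different
members: finitely many of them represent all the others. -/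
def IsConvergent {V : Type u} (G : SimpleGraph V) : Prop :=
  ∃ S : Finset ℕ, ∀ n : ℕ, ∃ m ∈ S,
    Nonempty ((iterCliqueGraph G n).graph ≃g (iterCliqueGraph G m).graph)

/-- `G` is divergent if it is not convergent. -/
def IsDivergent {V : Type u} (G : SimpleGraph V) : Prop :=
  ¬ IsConvergent G

/-- A collection of sets is intersecting if any two of its members have a common element. -/
def IsIntersecting {α : Type u} (F : Set (Set α)) : Prop :=
  ∀ A ∈ F, ∀ B ∈ F, (A ∩ B).Nonempty

/-- The Helly property: every (nonempty) intersecting subcollection has nonempty intersection. -/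
def HellyProperty {α : Type u} (C : Set (Set α)) : Prop :=
  ∀ F : Set (Set α), F ⊆ C → F.Nonempty → IsIntersecting F → (⋂₀ F).Nonempty

/-- `G` is (clique-)Helly if the collection of its cliques has the Helly property. -/
def IsHelly {V : Type u} (G : SimpleGraph V) : Prop :=
  HellyProperty {s : Set V | IsMaxClique G s}

end CliqueBehavior

/-! Helly implies convergent: in a finite Helly graph `H` every clique of `K(H)` consists of all
cliques through some vertex. Hence `K(H)` is Helly and `K²(H)` has at most as many vertices as `H`
(`IsHelly.cliqueGraph`, `IsHelly.card_le`). The orders stay bounded, which for finite graphs amounts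
to convergence.

For divergence, let `ℤ` act on a finite graph so that the generator moves every vertex to a
different, nonadjacent one; such an action passes to the clique graph. If `k ≥ 3` orbits are
completely joined to each other, then `K²` has `k + 1` such orbits (`HasRank.succ`): each old
representative yields one, and the cliques containing two of three chosen representatives yield
another. Representatives of joined orbits are distinct, so the orders are unbounded. It therefore
suffices to find three joined orbits in some iterate, either of the graph or of a retract of it
(`IsRetract.isBounded`).

A 2-regular graph is a disjoint union of cycles, and simultaneous rotation acts on its complement.
Three cycles give three joined orbits at once. Two cycles, one of length at least 6, and single
cycles of length at least 11 give them in `K²`, by majority families of scattered triples. Explicit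
intersecting families handle `C₁₀` and `C₅ ∪ C₅`, and one level higher `C₈`. The complement of `C₉`
retracts onto the octahedron, and those of `C₃ ∪ C₅` and `C₄ ∪ C₅` retract onto the complement of
`K₂ ∪ C₅`. All other nonempty cases satisfy the finite test `HellyCriterion`. -/

namespace CliqueBehavior

variable {V W : Type*}

/-! ### Touching vertices and maximal cliques -/

/-- Adjacency made reflexive. -/
def Touch (G : SimpleGraph V) (x y : V) : Prop := x = y ∨ G.Adj x y

theorem Touch.refl (G : SimpleGraph V) (x : V) : Touch G x x := Or.inl rfl

theorem Touch.symm {G : SimpleGraph V} {x y : V} (h : Touch G x y) : Touch G y x :=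
  h.elim (fun h => Or.inl h.symm) (fun h => Or.inr h.symm)

theorem touch_compl {G : SimpleGraph V} {x y : V} : Touch Gᶜ x y ↔ ¬ G.Adj x y := by
  by_cases h : x = y
  · subst h; simp [Touch]
  · simp [Touch, h]

theorem isClique_iff_touch {G : SimpleGraph V} {s : Set V} :
    G.IsClique s ↔ ∀ x ∈ s, ∀ y ∈ s, Touch G x y := by
  constructor
  · intro h x hx y hy
    by_cases hxy : x = y
    · exact Or.inl hxy
    · exact Or.inr (h hx hy hxy)
  · intro h x hx y hy hxy
    exact (h x hx y hy).resolve_left hxy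

theorem exists_maxClique [Finite V] {G : SimpleGraph V} {s : Set V} (hs : G.IsClique s) :
    ∃ t, s ⊆ t ∧ IsMaxClique G t :=
  (Set.toFinite {t | G.IsClique t}).exists_le_maximal hs

theorem touch_of_inter {G : SimpleGraph V} {P Q : {s : Set V // IsMaxClique G s}}
    (h : ((P : Set V) ∩ Q).Nonempty) : Touch (cliqueGraph G) P Q := by
  by_cases hPQ : P = Q
  · exact Or.inl hPQ
  · exact Or.inr ⟨hPQ, h⟩

theorem IsMaxClique.nonempty [Nonempty V] {G : SimpleGraph V} {s : Set V}
    (h : IsMaxClique G s) : s.Nonempty := by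
  by_contra hs
  rw [Set.not_nonempty_iff_eq_empty] at hs
  subst hs
  obtain ⟨v⟩ := ‹Nonempty V›
  exact h.le_of_ge (y := {v}) (by simp) (by simp) (Set.mem_singleton v)

theorem inter_of_touch [Nonempty V] {G : SimpleGraph V} {P Q : {s : Set V // IsMaxClique G s}}
    (h : Touch (cliqueGraph G) P Q) : ((P : Set V) ∩ Q).Nonempty := by
  rcases h with rfl | h
  · simpa using P.2.nonempty
  · exact h.2

theorem IsMaxClique.mem {G : SimpleGraph V} {s : Set V} (h : IsMaxClique G s) {v : V}
    (hv : ∀ w ∈ s, Touch G v w) : v ∈ s := by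
  refine h.le_of_ge (y := insert v s) ?_ (Set.subset_insert _ _) (Set.mem_insert _ _)
  rw [isClique_iff_touch]
  have h1 := isClique_iff_touch.1 h.prop
  rintro x (rfl | hx) y (rfl | hy)
  · exact Touch.refl _ _
  · exact hv y hy
  · exact (hv x hx).symm
  · exact h1 x hx y hy

theorem IsMaxClique.touch {G : SimpleGraph V} {s : Set V} (h : IsMaxClique G s) {v w : V}
    (hv : v ∈ s) (hw : w ∈ s) : Touch G v w :=
  isClique_iff_touch.1 h.prop v hv w hw

theorem isMaxClique_iff {G : SimpleGraph V} {s : Set V} :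
    IsMaxClique G s ↔ (∀ x ∈ s, ∀ y ∈ s, Touch G x y) ∧
      ∀ v, (∀ w ∈ s, Touch G v w) → v ∈ s := by
  refine ⟨fun h => ⟨isClique_iff_touch.1 h.prop, fun v hv => h.mem hv⟩, fun h => ?_⟩
  refine ⟨isClique_iff_touch.2 h.1, fun t ht hst v hv => h.2 v fun w hw => ?_⟩
  exact isClique_iff_touch.1 ht v hv w (hst hw)

instance [Nonempty V] [Finite V] (G : SimpleGraph V) :
    Nonempty {s : Set V // IsMaxClique G s} :=
  let ⟨t, _, ht⟩ := exists_maxClique (G := G) (s := ∅) (by simp)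
  ⟨⟨t, ht⟩⟩

instance finite_iterCliqueGraph {V : Type u} [Finite V] (G : SimpleGraph V) (n : ℕ) :
    Finite (iterCliqueGraph G n).Vert := by
  induction n with
  | zero => exact ‹Finite V›
  | succ n ih => exact Subtype.finite

instance nonempty_iterCliqueGraph {V : Type u} [Finite V] [Nonempty V] (G : SimpleGraph V)
    (n : ℕ) : Nonempty (iterCliqueGraph G n).Vert := by
  induction n with
  | zero => exact ‹Nonempty V›
  | succ n ih => exact inferInstanceAs (Nonempty {s : Set _ // IsMaxClique _ s})

/-! ### Convergence and boundedness -/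

/-- The iterated clique graphs of `G` have bounded orders. -/
def IsBounded {V : Type u} (G : SimpleGraph V) : Prop :=
  ∃ N, ∀ n, Nat.card (iterCliqueGraph G n).Vert ≤ N

theorem IsConvergent.isBounded {V : Type u} {G : SimpleGraph V} (h : IsConvergent G) :
    IsBounded G := by
  obtain ⟨S, hS⟩ := h
  refine ⟨∑ m ∈ S, Nat.card (iterCliqueGraph G m).Vert, fun n => ?_⟩
  obtain ⟨m, hm, ⟨e⟩⟩ := hS n
  rw [Nat.card_congr e.toEquiv]
  exact Finset.single_le_sum (f := fun m => Nat.card (iterCliqueGraph G m).Vert)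
    (fun _ _ => Nat.zero_le _) hm

/-- Only finitely many graphs live on the sets `Fin m` with `m ≤ N`; `code` transports every iterate
to one of them, and `r` picks one index per code. -/
theorem IsBounded.isConvergent {V : Type u} [Finite V] {G : SimpleGraph V} (h : IsBounded G) :
    IsConvergent G := by
  classical
  obtain ⟨N, hN⟩ := h
  have e (n : ℕ) : (iterCliqueGraph G n).Vert ≃ Fin (Nat.card (iterCliqueGraph G n).Vert) :=
    Finite.equivFin _
  let code (n : ℕ) : Σ m : Fin (N + 1), SimpleGraph (Fin m) :=
    ⟨⟨Nat.card (iterCliqueGraph G n).Vert, Nat.lt_succ_of_le (hN n)⟩,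
      (iterCliqueGraph G n).graph.map (e n).toEmbedding⟩
  have hiso (n m : ℕ) (h : code n = code m) :
      Nonempty ((iterCliqueGraph G n).graph ≃g (iterCliqueGraph G m).graph) := by
    have key : ∀ c d : Σ m : Fin (N + 1), SimpleGraph (Fin m), c = d → Nonempty (c.2 ≃g d.2) := by
      rintro c d rfl
      exact ⟨SimpleGraph.Iso.refl⟩
    obtain ⟨i⟩ := key _ _ h
    exact ⟨((SimpleGraph.Iso.map (e n) _).trans i).trans (SimpleGraph.Iso.map (e m) _).symm⟩
  have hfin : (Set.range code).Finite := Set.toFinite _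
  choose r hr using fun c : Set.range code => c.2
  have := hfin.fintype
  refine ⟨Finset.univ.image r, fun n => ⟨r ⟨code n, n, rfl⟩, by simp, ?_⟩⟩
  exact hiso _ _ (hr ⟨code n, n, rfl⟩).symm

/-! ### Retracts -/

/-- `H` is a retract of `G`, for maps that may identify adjacent vertices. -/
def IsRetract (H : SimpleGraph W) (G : SimpleGraph V) : Prop :=
  ∃ (f : W → V) (g : V → W), (∀ x y, Touch H x y → Touch G (f x) (f y)) ∧
    (∀ x y, Touch G x y → Touch H (g x) (g y)) ∧ ∀ x, g (f x) = x

theorem exists_maxClique_image [Finite V] {H : SimpleGraph W} {G : SimpleGraph V} {f : W → V}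
    (hf : ∀ x y, Touch H x y → Touch G (f x) (f y)) (Q : {s : Set W // IsMaxClique H s}) :
    ∃ P : {s : Set V // IsMaxClique G s}, f '' Q ⊆ P := by
  obtain ⟨t, h1, h2⟩ := exists_maxClique (G := G) (s := f '' Q) (by
    rw [isClique_iff_touch]
    rintro _ ⟨x, hx, rfl⟩ _ ⟨y, hy, rfl⟩
    exact hf _ _ (Q.2.touch hx hy))
  exact ⟨⟨t, h2⟩, h1⟩

/-- Images of cliques are complete, so they extend to cliques. Going there and back yields a clique
containing `g (f Q) = Q`, which equals `Q` by maximality. -/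
theorem IsRetract.cliqueGraph [Finite V] [Finite W] {H : SimpleGraph W} {G : SimpleGraph V}
    (h : IsRetract H G) : IsRetract (cliqueGraph H) (cliqueGraph G) := by
  obtain ⟨f, g, hf, hg, hgf⟩ := h
  choose F hF using exists_maxClique_image hf
  choose F' hF' using exists_maxClique_image hg
  refine ⟨F, F', ?_, ?_, fun Q => ?_⟩
  · rintro P Q (rfl | ⟨-, x, hx, hy⟩)
    · exact Touch.refl _ _
    · exact touch_of_inter ⟨f x, hF P ⟨x, hx, rfl⟩, hF Q ⟨x, hy, rfl⟩⟩
  · rintro P Q (rfl | ⟨-, x, hx, hy⟩)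
    · exact Touch.refl _ _
    · exact touch_of_inter ⟨g x, hF' P ⟨x, hx, rfl⟩, hF' Q ⟨x, hy, rfl⟩⟩
  · have : (Q : Set W) ⊆ F' (F Q) := fun x hx => by
      rw [← hgf x]
      exact hF' _ ⟨f x, hF _ ⟨x, hx, rfl⟩, rfl⟩
    exact Subtype.ext (Q.2.eq_of_le (F' (F Q)).2.prop this).symm

theorem IsRetract.iterCliqueGraph {V W : Type*} [Finite V] [Finite W] {H : SimpleGraph W}
    {G : SimpleGraph V} (h : IsRetract H G) (n : ℕ) :
    IsRetract (iterCliqueGraph H n).graph (iterCliqueGraph G n).graph := by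
  induction n with
  | zero => exact h
  | succ n ih => exact ih.cliqueGraph

theorem IsRetract.isBounded {V W : Type*} [Finite V] [Finite W] {H : SimpleGraph W}
    {G : SimpleGraph V} (h : IsRetract H G) (hG : IsBounded G) : IsBounded H := by
  obtain ⟨N, hN⟩ := hG
  refine ⟨N, fun n => le_trans ?_ (hN n)⟩
  obtain ⟨f, g, -, -, hgf⟩ := h.iterCliqueGraph n
  exact Nat.card_le_card_of_injective f (Function.LeftInverse.injective hgf)

theorem isRetract_compl_of_iso {H : SimpleGraph W} {G : SimpleGraph V} (e : H ≃g G) :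
    IsRetract Hᶜ Gᶜ := by
  refine ⟨e, e.symm, fun x y => ?_, fun x y => ?_, fun x => by simp⟩
  · rw [touch_compl, touch_compl, e.map_adj_iff]; exact id
  · rw [touch_compl, touch_compl, e.symm.map_adj_iff]; exact id

/-! ### Actions, joined orbits and divergence -/

/-- An action of `ℤ` on `V`. -/
structure Flow (V : Type*) where
  act : ℤ → V → V
  zero : ∀ x, act 0 x = x
  add : ∀ a b x, act (a + b) x = act a (act b x)

theorem Flow.neg_act (φ : Flow V) (a : ℤ) (x : V) : φ.act (-a) (φ.act a x) = x := by
  rw [← φ.add, neg_add_cancel, φ.zero]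

theorem Flow.act_neg (φ : Flow V) (a : ℤ) (x : V) : φ.act a (φ.act (-a) x) = x := by
  rw [← φ.add, add_neg_cancel, φ.zero]

/-- The action is by automorphisms of `G`, and its generator moves every vertex to a different
vertex not adjacent to it. -/
structure Flow.IsCoaffine (φ : Flow V) (G : SimpleGraph V) : Prop where
  touch : ∀ a x y, Touch G x y → Touch G (φ.act a x) (φ.act a y)
  free : ∀ x, ¬ Touch G x (φ.act 1 x)

theorem Flow.IsCoaffine.image_isMaxClique {φ : Flow V} {G : SimpleGraph V} (h : φ.IsCoaffine G)
    (a : ℤ) {s : Set V} (hs : IsMaxClique G s) : IsMaxClique G (φ.act a '' s) := by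
  rw [isMaxClique_iff] at hs ⊢
  constructor
  · rintro _ ⟨x, hx, rfl⟩ _ ⟨y, hy, rfl⟩
    exact h.touch _ _ _ (hs.1 x hx y hy)
  · intro v hv
    refine ⟨φ.act (-a) v, hs.2 _ fun w hw => ?_, φ.act_neg a v⟩
    have := h.touch (-a) _ _ (hv _ ⟨w, hw, rfl⟩)
    rwa [φ.neg_act] at this

/-- The action induced on the clique graph. -/
def Flow.cliqueFlow (φ : Flow V) {G : SimpleGraph V} (h : φ.IsCoaffine G) :
    Flow {s : Set V // IsMaxClique G s} where
  act a Q := ⟨φ.act a '' Q, h.image_isMaxClique a Q.2⟩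
  zero Q := Subtype.ext (by simp [φ.zero])
  add a b Q := Subtype.ext (by simp [φ.add, Set.image_image])

/-- If a clique met its image under the generator, it would contain some `y` together with the
translate of `y`, and these do not touch. -/
theorem Flow.IsCoaffine.cliqueGraph [Nonempty V] {φ : Flow V} {G : SimpleGraph V}
    (h : φ.IsCoaffine G) : (φ.cliqueFlow h).IsCoaffine (cliqueGraph G) where
  touch a P Q hPQ := by
    obtain ⟨x, hx, hy⟩ := inter_of_touch hPQ
    exact touch_of_inter ⟨φ.act a x, ⟨x, hx, rfl⟩, ⟨x, hy, rfl⟩⟩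
  free Q hQ := by
    obtain ⟨_, hx, ⟨y, hy, rfl⟩⟩ := inter_of_touch hQ
    exact h.free y (Q.2.touch hy hx)

/-- Some coaffine action on `G` has `k` orbits that are completely joined to each other. -/
def HasRank (G : SimpleGraph V) (k : ℕ) : Prop :=
  ∃ φ : Flow V, φ.IsCoaffine G ∧
    ∃ x : Fin k → V, ∀ i j, i < j → ∀ a, Touch G (x i) (φ.act a (x j))

theorem HasRank.le_card [Finite V] {G : SimpleGraph V} {k : ℕ} (h : HasRank G k) :
    k ≤ Nat.card V := by
  obtain ⟨φ, hφ, x, hx⟩ := h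
  -- If the two coincided, `x j` would touch its own translate.
  have hne (i j) (hij : i < j) : x i ≠ x j := fun h => hφ.free (x j) (h ▸ hx i j hij 1)
  have hinj : Function.Injective x := by
    intro i j hij
    rcases lt_trichotomy i j with h | h | h
    · exact absurd hij (hne _ _ h)
    · exact h
    · exact absurd hij.symm (hne _ _ h)
  simpa using Nat.card_le_card_of_injective x hinj

/-- Families of complete sets of vertices that produce vertices of `K²(G)` with completely joined
orbits. -/
structure IsJoinedFamily (G : SimpleGraph V) (φ : Flow V) {k : ℕ}
    (M : Fin k → Set (Set V)) : Prop where
  inter : ∀ i, ∀ S ∈ M i, ∀ T ∈ M i, (S ∩ T).Nonempty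
  joined : ∀ i j, i < j → ∀ a, ∃ S ∈ M i, ∃ T ∈ M j, G.IsClique (S ∪ φ.act a '' T)

/-- The cliques containing some member of `M i` pairwise meet, so they lie in a vertex `y i` of
`K²(G)`. A clique containing `S ∪ a·T` then belongs to both `y i` and the translate `a·(y j)`, which
therefore touch. -/
theorem IsJoinedFamily.hasRank [Finite V] [Nonempty V] {G : SimpleGraph V} {φ : Flow V}
    (hφ : φ.IsCoaffine G) {k : ℕ} {M : Fin k → Set (Set V)} (hM : IsJoinedFamily G φ M) :
    HasRank (cliqueGraph (cliqueGraph G)) k := by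
  have hex (i : Fin k) : ∃ y : {s : Set _ // IsMaxClique (cliqueGraph G) s},
      ∀ Q : {s : Set V // IsMaxClique G s}, (∃ S ∈ M i, S ⊆ Q) → Q ∈ (y : Set _) := by
    obtain ⟨t, h1, h2⟩ := exists_maxClique (G := cliqueGraph G)
      (s := {Q | ∃ S ∈ M i, S ⊆ (Q : Set V)}) (by
        rw [isClique_iff_touch]
        rintro P ⟨S, hS, hSP⟩ Q ⟨T, hT, hTQ⟩
        exact touch_of_inter ((hM.inter i S hS T hT).mono (Set.inter_subset_inter hSP hTQ)))
    exact ⟨⟨t, h2⟩, fun Q hQ => h1 hQ⟩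
  choose y hy using hex
  refine ⟨(φ.cliqueFlow hφ).cliqueFlow hφ.cliqueGraph, hφ.cliqueGraph.cliqueGraph, y, ?_⟩
  intro i j hij a
  obtain ⟨S, hS, T, hT, hST⟩ := hM.joined i j hij a
  obtain ⟨Q, hQ, hQ'⟩ := exists_maxClique hST
  refine touch_of_inter ⟨⟨Q, hQ'⟩, hy i _ ⟨S, hS, Set.subset_union_left.trans hQ⟩, ?_⟩
  refine ⟨(φ.cliqueFlow hφ).act (-a) ⟨Q, hQ'⟩, hy j _ ⟨T, hT, fun t ht => ?_⟩,
    (φ.cliqueFlow hφ).act_neg a _⟩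
  exact ⟨φ.act a t, hQ (Or.inr ⟨t, ht, rfl⟩), φ.neg_act a t⟩

/-- Three joined orbits produce a further one in `K²(G)`, by majority voting. -/
theorem HasRank.succ [Finite V] [Nonempty V] {G : SimpleGraph V} {k : ℕ}
    (h : HasRank G (k + 3)) : HasRank (cliqueGraph (cliqueGraph G)) (k + 4) := by
  obtain ⟨φ, hφ, x, hx⟩ := h
  have hx' (i j) (hij : i ≠ j) (a : ℤ) : Touch G (x i) (φ.act a (x j)) := by
    rcases lt_or_gt_of_ne hij with h | h
    · exact hx i j h a
    · have := hφ.touch a _ _ (hx j i h (-a))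
      rw [φ.act_neg] at this
      exact this.symm
  have hx0 (i j) (hij : i ≠ j) : Touch G (x i) (x j) := by simpa [φ.zero] using hx' i j hij 0
  -- The pairs among the first three representatives; any two of them meet. Together with the
  -- singletons they form the `k + 4` families.
  let P : Set (Set V) := {S | ∃ i j : Fin (k + 3), i < j ∧ (j : ℕ) < 3 ∧ S = {x i, x j}}
  refine IsJoinedFamily.hasRank hφ
    (M := Fin.snoc (α := fun _ => Set (Set V)) (fun i => {{x i}}) P) ⟨?_, ?_⟩
  · intro i
    induction i using Fin.lastCases with
    | last =>
      simp only [Fin.snoc_last]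
      rintro _ ⟨a, b, hab, hb, rfl⟩ _ ⟨c, d, hcd, hd, rfl⟩
      have h3 : a = c ∨ a = d ∨ b = c ∨ b = d := by
        simp only [Fin.lt_def, Fin.ext_iff] at *
        omega
      rcases h3 with rfl | rfl | rfl | rfl
      · exact ⟨x a, by simp⟩
      · exact ⟨x a, by simp⟩
      · exact ⟨x b, by simp⟩
      · exact ⟨x b, by simp⟩
    | cast i =>
      simp only [Fin.snoc_castSucc]
      rintro S rfl T rfl
      exact ⟨x i, by simp⟩
  · intro i j hij a
    have hi : i ≠ Fin.last _ := fun h => absurd (Fin.le_last j) (by rw [← h]; exact not_le.2 hij)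
    obtain ⟨i, rfl⟩ := Fin.exists_castSucc_eq.2 hi
    simp only [Fin.snoc_castSucc]
    refine ⟨{x i}, rfl, ?_⟩
    induction j using Fin.lastCases with
    | last =>
      simp only [Fin.snoc_last]
      -- The pair must avoid `i`, because `x i` need not touch the translates of itself.
      obtain ⟨c, d, hcd, hd, hc', hd'⟩ : ∃ c d : Fin (k + 3), c < d ∧ (d : ℕ) < 3 ∧ i ≠ c ∧
          i ≠ d := by
        by_cases h0 : (i : ℕ) = 0
        · exact ⟨⟨1, by omega⟩, ⟨2, by omega⟩, by simp [Fin.lt_def], by simp, by simp [Fin.ext_iff, h0],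
            by simp [Fin.ext_iff, h0]⟩
        · by_cases h1 : (i : ℕ) = 1
          · exact ⟨⟨0, by omega⟩, ⟨2, by omega⟩, by simp [Fin.lt_def], by simp, by simp [Fin.ext_iff, h1],
              by simp [Fin.ext_iff, h1]⟩
          · exact ⟨⟨0, by omega⟩, ⟨1, by omega⟩, by simp, by simp, by simp [Fin.ext_iff, h0],
              by simp [Fin.ext_iff, h1]⟩
      refine ⟨_, ⟨c, d, hcd, hd, rfl⟩, ?_⟩
      rw [isClique_iff_touch]
      have e1 := hx' i c hc' a
      have e2 := hx' i d hd' a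
      have e3 := hφ.touch a _ _ (hx0 c d hcd.ne)
      simp only [Set.image_pair, Set.mem_union, Set.mem_singleton_iff, Set.mem_insert_iff]
      rintro _ (rfl | rfl | rfl) _ (rfl | rfl | rfl) <;>
        first
          | exact Touch.refl _ _
          | assumption
          | (apply Touch.symm; assumption)
    | cast j =>
      simp only [Fin.snoc_castSucc]
      refine ⟨{x j}, rfl, ?_⟩
      rw [isClique_iff_touch]
      have hne : i ≠ j := fun h => absurd hij (by simp [h])
      have e1 := hx' i j hne a
      simp only [Set.image_singleton, Set.mem_union, Set.mem_singleton_iff]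
      rintro _ (rfl | rfl) _ (rfl | rfl) <;>
        first
          | exact Touch.refl _ _
          | assumption
          | (apply Touch.symm; assumption)

/-- The number of joined orbits grows by one every two iterations and is at most the order. -/
theorem not_isBounded_of_hasRank {V : Type u} [Finite V] [Nonempty V] {G : SimpleGraph V} {m : ℕ}
    (h : HasRank (iterCliqueGraph G m).graph 3) : ¬ IsBounded G := by
  rintro ⟨N, hN⟩
  have key (k : ℕ) : ∃ n, HasRank (iterCliqueGraph G n).graph (k + 3) := by
    induction k with
    | zero => exact ⟨m, h⟩
    | succ k ih =>
      obtain ⟨n, hn⟩ := ih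
      exact ⟨n + 2, hn.succ⟩
  obtain ⟨n, hn⟩ := key N
  have := hn.le_card
  have := hN n
  omega

/-! ### Helly graphs are convergent -/

/-- Every triple of vertices of `G` has a vertex touching all the vertices that touch two touching
vertices of the triple; stated for the complement of `G`. -/
def HellyCriterion (G : SimpleGraph V) : Prop :=
  ∀ a b c, ∃ v, ∀ w, (¬ G.Adj a b ∧ ¬ G.Adj w a ∧ ¬ G.Adj w b) ∨
    (¬ G.Adj a c ∧ ¬ G.Adj w a ∧ ¬ G.Adj w c) ∨ (¬ G.Adj b c ∧ ¬ G.Adj w b ∧ ¬ G.Adj w c) →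
      ¬ G.Adj v w

instance [Fintype V] (G : SimpleGraph V) [DecidableRel G.Adj] : Decidable (HellyCriterion G) :=
  inferInstanceAs (Decidable (∀ a b c, ∃ v, ∀ w, (¬ G.Adj a b ∧ ¬ G.Adj w a ∧ ¬ G.Adj w b) ∨
    (¬ G.Adj a c ∧ ¬ G.Adj w a ∧ ¬ G.Adj w c) ∨ (¬ G.Adj b c ∧ ¬ G.Adj w b ∧ ¬ G.Adj w c) →
      ¬ G.Adj v w))

theorem HellyCriterion.of_iso {H : SimpleGraph W} {G : SimpleGraph V} (e : H ≃g G)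
    (h : HellyCriterion H) : HellyCriterion G := by
  intro a b c
  obtain ⟨v, hv⟩ := h (e.symm a) (e.symm b) (e.symm c)
  refine ⟨e v, fun w => ?_⟩
  have h1 : G.Adj (e v) w ↔ H.Adj v (e.symm w) := by
    rw [← e.symm.map_adj_iff, e.symm_apply_apply]
  simpa only [e.symm.map_adj_iff, h1] using hv (e.symm w)

/-- A finite family of cliques whose members pairwise intersect has a common vertex. -/
theorem HellyCriterion.exists_mem [Nonempty V] {G : SimpleGraph V} (h : HellyCriterion G)
    (F : Finset (Set V)) (hF : ∀ A ∈ F, IsMaxClique Gᶜ A) (hint : IsIntersecting (F : Set (Set V))) :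
    ∃ v, ∀ A ∈ F, v ∈ A := by
  classical
  induction hn : F.card using Nat.strong_induction_on generalizing F with
  | _ n ih =>
    subst hn
    by_cases h3 : 3 ≤ F.card
    · obtain ⟨T, hTF, hT⟩ := Finset.exists_subset_card_eq h3
      obtain ⟨A, B, C, hAB, hAC, hBC, rfl⟩ := Finset.card_eq_three.1 hT
      simp only [Finset.insert_subset_iff, Finset.singleton_subset_iff] at hTF
      -- By induction, omitting `A`, `B` or `C` leaves a family with a common point. Each member of
      -- `F` then contains at least two of `a`, `b`, `c`, so the vertex `v` of the criterion touches
      -- all of it and lies in it by maximality.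
      have sub (A) (hA : A ∈ F) : ∃ v, ∀ B ∈ F, B ≠ A → v ∈ B := by
        obtain ⟨v, hv⟩ := ih _ (Finset.card_erase_lt_of_mem hA) (F.erase A)
          (fun B hB => hF B (Finset.mem_of_mem_erase hB))
          (fun B hB C hC => hint B (Finset.mem_of_mem_erase hB) C (Finset.mem_of_mem_erase hC)) rfl
        exact ⟨v, fun B hB hBA => hv B (Finset.mem_erase.2 ⟨hBA, hB⟩)⟩
      obtain ⟨a, ha⟩ := sub A hTF.1
      obtain ⟨b, hb⟩ := sub B hTF.2.1
      obtain ⟨c, hc⟩ := sub C hTF.2.2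
      obtain ⟨v, hv⟩ := h a b c
      refine ⟨v, fun D hD => (hF D hD).mem fun w hw => touch_compl.2 ?_⟩
      have tch {x y : V} (hx : x ∈ D) (hy : y ∈ D) : ¬ G.Adj x y :=
        touch_compl.1 ((hF D hD).touch hx hy)
      by_cases hDA : D = A
      · have h1 := hb D hD (hDA ▸ hAB)
        have h2 := hc D hD (hDA ▸ hAC)
        exact hv w (Or.inr (Or.inr ⟨tch h1 h2, tch hw h1, tch hw h2⟩))
      · have h1 := ha D hD hDA
        by_cases hDB : D = B
        · have h2 := hc D hD (hDB ▸ hBC)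
          exact hv w (Or.inr (Or.inl ⟨tch h1 h2, tch hw h1, tch hw h2⟩))
        · have h2 := hb D hD hDB
          exact hv w (Or.inl ⟨tch h1 h2, tch hw h1, tch hw h2⟩)
    · rcases F.eq_empty_or_nonempty with rfl | ⟨A, hA⟩
      · obtain ⟨v⟩ := ‹Nonempty V›
        exact ⟨v, by simp⟩
      · by_cases h1 : F = {A}
        · obtain ⟨v, hv, -⟩ := hint A hA A hA
          exact ⟨v, by simpa [h1] using hv⟩
        · obtain ⟨B, hB, hBA⟩ : ∃ B ∈ F, B ≠ A := by
            by_contra! hc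
            exact h1 (Finset.eq_singleton_iff_unique_mem.2 ⟨hA, hc⟩)
          obtain ⟨v, hv⟩ := hint A hA B hB
          refine ⟨v, fun C hC => ?_⟩
          by_cases hCA : C = A
          · exact hCA ▸ hv.1
          by_cases hCB : C = B
          · exact hCB ▸ hv.2
          exfalso
          apply h3
          rw [← Finset.card_eq_three.2 ⟨A, B, C, hBA.symm, Ne.symm hCA, Ne.symm hCB, rfl⟩]
          exact Finset.card_le_card (by simp [Finset.insert_subset_iff, hA, hB, hC])

theorem HellyCriterion.isHelly [Finite V] [Nonempty V] {G : SimpleGraph V}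
    (h : HellyCriterion G) : IsHelly Gᶜ := by
  intro F hF _ hint
  obtain ⟨v, hv⟩ := h.exists_mem (Set.toFinite F).toFinset (fun A hA => hF (by simpa using hA))
    (by simpa using hint)
  exact ⟨v, fun A hA => hv A (by simpa using hA)⟩

theorem isHelly_of_isEmpty [IsEmpty V] (G : SimpleGraph V) : IsHelly G := by
  rintro F - ⟨A, hA⟩ hint
  obtain ⟨x, -⟩ := hint A hA A hA
  exact isEmptyElim x

theorem IsHelly.exists_common [Nonempty V] {G : SimpleGraph V} (h : IsHelly G)
    {P : Set {s : Set V // IsMaxClique G s}} (hP : IsMaxClique (cliqueGraph G) P) :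
    ∃ v, ∀ Q, Q ∈ P ↔ v ∈ (Q : Set V) := by
  have hne : P.Nonempty := by
    rw [Set.nonempty_iff_ne_empty]
    -- The empty set is maximal only if `K(G)` has no vertices; as `V` may be infinite, Zorn's lemma
    -- supplies a clique.
    rintro rfl
    by_cases hK : Nonempty {s : Set V // IsMaxClique G s}
    · exact hP.nonempty.ne_empty rfl
    · obtain ⟨v⟩ := ‹Nonempty V›
      obtain ⟨t, -, ht⟩ := zorn_subset_nonempty {s : Set V | G.IsClique s} (by
        intro c hc hchain _
        refine ⟨⋃₀ c, ?_, fun s hs => Set.subset_sUnion_of_mem hs⟩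
        exact (Set.pairwise_sUnion hchain.directedOn).2 hc) {v} (by simp)
      exact hK ⟨t, ht⟩
  obtain ⟨v, hv⟩ := h (Subtype.val '' P) (by rintro _ ⟨Q, -, rfl⟩; exact Q.2) (hne.image _) (by
    rintro _ ⟨Q, hQ, rfl⟩ _ ⟨R, hR, rfl⟩
    exact inter_of_touch (hP.touch hQ hR))
  have hv' (Q) (hQ : Q ∈ P) : v ∈ (Q : Set V) := hv _ ⟨Q, hQ, rfl⟩
  exact ⟨v, fun Q => ⟨hv' Q, fun hQ => hP.mem fun R hR => touch_of_inter ⟨v, hQ, hv' R hR⟩⟩⟩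

/-- Each clique of `K(G)` is the star of a vertex. For intersecting stars these vertices touch, and
a clique of `G` through all of them is common to all the stars. -/
theorem IsHelly.cliqueGraph [Finite V] [Nonempty V] {G : SimpleGraph V} (h : IsHelly G) :
    IsHelly (cliqueGraph G) := by
  intro F hF _ hint
  choose v hv using fun P : F => h.exists_common (hF P.2)
  obtain ⟨t, ht, ht'⟩ := exists_maxClique (G := G) (s := Set.range v) (by
    rw [isClique_iff_touch]
    rintro _ ⟨P, rfl⟩ _ ⟨R, rfl⟩
    obtain ⟨Q, hQ, hQ'⟩ := hint P P.2 R R.2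
    exact Q.2.touch ((hv P Q).1 hQ) ((hv R Q).1 hQ'))
  exact ⟨⟨t, ht'⟩, fun P hP => (hv ⟨P, hP⟩ _).2 (ht ⟨⟨P, hP⟩, rfl⟩)⟩

theorem IsHelly.card_le [Finite V] [Nonempty V] {G : SimpleGraph V} (h : IsHelly G) :
    Nat.card {s // IsMaxClique (CliqueBehavior.cliqueGraph G) s} ≤ Nat.card V := by
  choose v hv using fun P : {s // IsMaxClique (CliqueBehavior.cliqueGraph G) s} =>
    h.exists_common P.2
  refine Nat.card_le_card_of_injective v fun P R hPR => Subtype.ext (Set.ext fun Q => ?_)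
  rw [hv P, hv R, hPR]

theorem IsHelly.isBounded {V : Type u} [Finite V] {G : SimpleGraph V} (h : IsHelly G) :
    IsBounded G := by
  have step {W : Type u} [Finite W] [Nonempty W] {H : SimpleGraph W} (h : IsHelly H) (n : ℕ) :
      IsHelly (iterCliqueGraph H n).graph := by
    induction n with
    | zero => exact h
    | succ n ih => exact ih.cliqueGraph
  have bound {W : Type u} [Finite W] [Nonempty W] {H : SimpleGraph W} (h : IsHelly H) (n : ℕ) :
      Nat.card (iterCliqueGraph H n).Vert ≤
        Nat.card (iterCliqueGraph H 0).Vert + Nat.card (iterCliqueGraph H 1).Vert := by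
    induction n using Nat.twoStepInduction with
    | zero => omega
    | one => omega
    | more n ih _ => exact ((step h n).card_le).trans ih
  rcases isEmpty_or_nonempty V with hV | hV
  -- The empty graph has the empty set as its only clique, so no iterate has more than one vertex.
  · have one (n : ℕ) : Subsingleton (iterCliqueGraph G n).Vert := by
      induction n with
      | zero => exact inferInstanceAs (Subsingleton V)
      | succ n ih =>
        have univ (P : {s // IsMaxClique (iterCliqueGraph G n).graph s}) :
            (P : Set (iterCliqueGraph G n).Vert) = Set.univ :=
          Set.eq_univ_of_forall fun v => P.2.mem fun w _ => Or.inl (Subsingleton.elim _ _)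
        exact ⟨fun P R => Subtype.ext ((univ P).trans (univ R).symm)⟩
    exact ⟨1, fun n => Finite.card_le_one_iff_subsingleton.2 (one n)⟩
  · exact ⟨_, bound h⟩

/-! ### Decomposition of 2-regular graphs into cycles -/

/-- The graph joining every vertex to its translate by the generator of the action. -/
def Flow.graph (φ : Flow V) : SimpleGraph V := SimpleGraph.fromRel fun x y => y = φ.act 1 x

instance [DecidableEq V] (φ : Flow V) : DecidableRel φ.graph.Adj :=
  inferInstanceAs (DecidableRel (SimpleGraph.fromRel fun x y => y = φ.act 1 x).Adj)

theorem Flow.graph_adj {φ : Flow V} {x y : V} :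
    φ.graph.Adj x y ↔ x ≠ y ∧ (y = φ.act 1 x ∨ x = φ.act 1 y) := Iff.rfl

theorem Flow.act_injective (φ : Flow V) (a : ℤ) : Function.Injective (φ.act a) :=
  Function.LeftInverse.injective (φ.neg_act a)

theorem Flow.act_comm (φ : Flow V) (a b : ℤ) (x : V) :
    φ.act a (φ.act b x) = φ.act b (φ.act a x) := by
  rw [← φ.add, ← φ.add, add_comm]

theorem Flow.isCoaffine (φ : Flow V) (h : ∀ x, φ.act 1 x ≠ x) : φ.IsCoaffine φ.graphᶜ where
  touch a x y := by
    rw [touch_compl, touch_compl, Flow.graph_adj, Flow.graph_adj, φ.act_comm 1, φ.act_comm 1,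
      (φ.act_injective a).eq_iff, (φ.act_injective a).eq_iff, (φ.act_injective a).ne_iff]
    exact id
  free x := by
    rw [touch_compl, not_not, Flow.graph_adj]
    exact ⟨(h x).symm, Or.inl rfl⟩

def Flow.isoOfEquiv {φ : Flow V} {ψ : Flow W} (e : V ≃ W)
    (h : ∀ x, e (φ.act 1 x) = ψ.act 1 (e x)) : φ.graph ≃g ψ.graph where
  toEquiv := e
  map_rel_iff' := by
    intro x y
    rw [Flow.graph_adj, Flow.graph_adj, ← h, ← h, e.apply_eq_iff_eq, e.apply_eq_iff_eq,
      e.injective.ne_iff]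

/-- Simultaneous rotation of a family of cycles. -/
def cyclesFlow {ι : Type*} (n : ι → ℕ) : Flow (Σ c, ZMod (n c)) where
  act a x := ⟨x.1, x.2 + a⟩
  zero x := by simp
  add a b x := by simp [add_comm, add_left_comm]

/-- A two-way infinite sequence of vertices that covers a component of a 2-regular graph. -/
structure IsCovering (G : SimpleGraph V) (w : ℤ → V) : Prop where
  adj_iff : ∀ i y, G.Adj (w i) y ↔ y = w (i - 1) ∨ y = w (i + 1)
  ne : ∀ i, w (i - 1) ≠ w (i + 1)

theorem IsCovering.adj {G : SimpleGraph V} {w : ℤ → V} (h : IsCovering G w) (i : ℤ) :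
    G.Adj (w i) (w (i + 1)) := (h.adj_iff i _).2 (Or.inr rfl)

/-- Walking on without turning back is an injective map on the finite set of directed edges, hence a
permutation; its integer powers give the two-way walk. -/
theorem exists_isCovering [Fintype V] {G : SimpleGraph V} [DecidableRel G.Adj]
    (hG : G.IsRegularOfDegree 2) (v : V) : ∃ w, IsCovering G w ∧ w 0 = v := by
  classical
  have hex (p : {p : V × V // G.Adj p.1 p.2}) :
      ∃ q, q ≠ p.1.1 ∧ ∀ y, G.Adj p.1.2 y ↔ y = p.1.1 ∨ y = q := by
    obtain ⟨⟨u, v⟩, huv⟩ := p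
    have := hG v
    rw [← SimpleGraph.card_neighborFinset_eq_degree, Finset.card_eq_two] at this
    obtain ⟨a, b, hab, h⟩ := this
    have h' (y) : G.Adj v y ↔ y = a ∨ y = b := by
      rw [← SimpleGraph.mem_neighborFinset, h]; simp
    rcases (h' u).1 huv.symm with rfl | rfl
    · exact ⟨b, hab.symm, h'⟩
    · exact ⟨a, hab, fun y => (h' y).trans or_comm⟩
  choose q hq hadj using hex
  let next (p : {p : V × V // G.Adj p.1 p.2}) : {p : V × V // G.Adj p.1 p.2} :=
    ⟨(p.1.2, q p), (hadj p _).2 (Or.inr rfl)⟩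
  have hinj : Function.Injective next := by
    intro p p' h
    have h1 : p.1.2 = p'.1.2 := congrArg (fun e => e.1.1) h
    have h2 : q p = q p' := congrArg (fun e => e.1.2) h
    have h3 : p'.1.1 = p.1.1 :=
      ((hadj p _).1 (h1 ▸ p'.2.symm)).resolve_right (h2 ▸ (hq p').symm)
    exact Subtype.ext (Prod.ext h3.symm h1)
  let N := Equiv.ofBijective next (Finite.injective_iff_bijective.1 hinj)
  obtain ⟨u, hu⟩ : ∃ u, G.Adj v u := by
    have : 0 < G.degree v := by rw [hG v]; omega
    exact (G.degree_pos_iff_exists_adj v).1 this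
  let d : {p : V × V // G.Adj p.1 p.2} := ⟨(v, u), hu⟩
  have hN (i : ℤ) : (N ^ (i + 1)) d = next ((N ^ i) d) := by
    rw [add_comm, zpow_add, zpow_one]; rfl
  refine ⟨fun i => ((N ^ i) d).1.1, ⟨fun i y => ?_, fun i => ?_⟩, rfl⟩
  all_goals
    obtain ⟨j, rfl⟩ : ∃ j, i = j + 1 := ⟨i - 1, by ring⟩
    simp only [hN, add_sub_cancel_right]
  · exact hadj _ y
  · exact (hq _).symm

theorem IsCovering.eq_add {G : SimpleGraph V} {w w' : ℤ → V} (h : IsCovering G w)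
    (h' : IsCovering G w') (h0 : w 0 = w' 0) (h1 : w 1 = w' 1) (k : ℤ) : w k = w' k := by
  have key (k : ℤ) : w k = w' k ∧ w (k + 1) = w' (k + 1) := by
    induction k using Int.induction_on with
    | zero => exact ⟨h0, by simpa using h1⟩
    | succ i ih =>
      refine ⟨ih.2, ?_⟩
      have e := (h'.adj_iff (i + 1) _).1 (ih.2 ▸ h.adj (i + 1))
      have e' := h.ne (i + 1)
      rw [add_sub_cancel_right] at e e'
      rw [← ih.1] at e
      exact e.resolve_left e'.symm
    | pred i ih =>
      have e := (h'.adj_iff (-i) (w (-i - 1))).1 (ih.1 ▸ (h.adj_iff _ _).2 (Or.inl rfl))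
      rw [← ih.2] at e
      exact ⟨e.resolve_right (h.ne _), by rw [sub_add_cancel]; exact ih.1⟩
  exact (key k).1

theorem IsCovering.shift {G : SimpleGraph V} {w : ℤ → V} (h : IsCovering G w) (a : ℤ) :
    IsCovering G fun k => w (a + k) where
  adj_iff i y := by rw [h.adj_iff, add_sub_assoc, add_assoc]
  ne i := by rw [← add_sub_assoc, ← add_assoc]; exact h.ne _

theorem IsCovering.reflect {G : SimpleGraph V} {w : ℤ → V} (h : IsCovering G w) (a : ℤ) :
    IsCovering G fun k => w (a - k) where
  adj_iff i y := by
    rw [h.adj_iff, or_comm, show a - (i - 1) = a - i + 1 by ring,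
      show a - (i + 1) = a - i - 1 by ring]
  ne i := by
    rw [show a - (i - 1) = a - i + 1 by ring, show a - (i + 1) = a - i - 1 by ring]
    exact (h.ne _).symm

/-- A mirror symmetry would force a step back at its centre if `s` is even, and a loop if `s` is
odd. -/
theorem IsCovering.ne_reflect {G : SimpleGraph V} {w : ℤ → V} (h : IsCovering G w) (s : ℤ) :
    ∃ k, w k ≠ w (s - k) := by
  by_contra! hc
  rcases Int.even_or_odd' s with ⟨m, rfl | rfl⟩
  · apply h.ne m
    rw [hc (m - 1)]
    congr 1; ring
  · apply (h.adj m).ne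
    rw [hc m]
    congr 1; ring

/-- After a repeated vertex the walk continues in the same or in the opposite direction; the
opposite one would make it mirror symmetric. -/
theorem IsCovering.periodic {G : SimpleGraph V} {w : ℤ → V} (h : IsCovering G w) {i j : ℤ}
    (hij : w i = w j) (k : ℤ) : w (k + (j - i)) = w k := by
  have e := (h.adj_iff j _).1 (hij ▸ h.adj i)
  rcases e with e | e
  · obtain ⟨m, hm⟩ := h.ne_reflect (i + j)
    have := (h.shift i).eq_add (h.reflect j) (by simpa using hij) e (m - i)
    exact absurd (by convert this using 2 <;> ring) hm
  · have := (h.shift i).eq_add (h.shift j) (by simpa using hij) e (k - i)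
    rw [eq_comm]
    convert this using 2 <;> ring

/-- The periods form a subgroup of `ℤ`. Its generator is not 0 by finiteness, not 1 since there are
no loops, and not 2 since the walk never turns back. -/
theorem IsCovering.exists_period [Finite V] {G : SimpleGraph V} {w : ℤ → V}
    (h : IsCovering G w) : ∃ n : ℕ, 3 ≤ n ∧ ∀ i j, w i = w j ↔ (n : ℤ) ∣ j - i := by
  let H : AddSubgroup ℤ :=
    { carrier := {p | ∀ k, w (k + p) = w k}
      zero_mem' := by simp
      add_mem' := fun {a b} ha hb k => by rw [← add_assoc, hb, ha]
      neg_mem' := fun {a} ha k => by rw [← ha (k + -a), neg_add_cancel_right] }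
  obtain ⟨p, hp⟩ := Int.subgroup_cyclic H
  have hH (i j) : w i = w j ↔ (p.natAbs : ℤ) ∣ j - i := by
    rw [Int.natAbs_dvd, ← Int.mem_zmultiples_iff, AddSubgroup.zmultiples_eq_closure, ← hp]
    refine ⟨fun hij => h.periodic hij, fun hij => ?_⟩
    have := hij i
    rw [add_sub_cancel] at this
    exact this.symm
  refine ⟨p.natAbs, ?_, hH⟩
  have h0 : p.natAbs ≠ 0 := by
    intro h0
    have : Function.Injective w := by
      intro i j hij
      rw [hH, h0] at hij
      simp at hij
      omega
    exact not_injective_infinite_finite w this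
  have h1 : p.natAbs ≠ 1 := by
    intro h1
    refine (h.adj 0).ne ((hH _ _).2 ?_)
    rw [h1]; simp
  have h2 : p.natAbs ≠ 2 := by
    intro h2
    refine h.ne 0 ((hH _ _).2 ?_)
    rw [h2]; norm_num
  omega

theorem exists_iso_cycles {V : Type u} [Fintype V] {G : SimpleGraph V} [DecidableRel G.Adj]
    (hG : G.IsRegularOfDegree 2) : ∃ (ι : Type u) (_ : Finite ι) (n : ι → ℕ), (∀ c, 3 ≤ n c) ∧
      Nonempty ((cyclesFlow n).graph ≃g G) := by
  have hcov (c : G.ConnectedComponent) : ∃ w, IsCovering G w ∧ G.connectedComponentMk (w 0) = c := by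
    obtain ⟨v, rfl⟩ := c.exists_rep
    obtain ⟨w, hw, rfl⟩ := exists_isCovering hG v
    exact ⟨w, hw, rfl⟩
  choose w hw hwc using hcov
  choose n hn hper using fun c => (hw c).exists_period
  have hcomp (c) (i : ℤ) : G.connectedComponentMk (w c i) = c := by
    induction i using Int.induction_on with
    | zero => exact hwc c
    | succ i ih =>
      refine (SimpleGraph.ConnectedComponent.eq.2 ?_).trans ih
      exact ((hw c).adj i).symm.reachable
    | pred i ih =>
      refine (SimpleGraph.ConnectedComponent.eq.2 ?_).trans ih
      exact (((hw c).adj_iff _ _).2 (Or.inl rfl)).symm.reachable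
  -- One cycle for each connected component, of length the period of its covering walk.
  let F : (Σ c, ZMod (n c)) → V := fun x => w x.1 (x.2.cast : ℤ)
  have hF (c) (i : ℤ) : F ⟨c, i⟩ = w c i := by
    refine (hper c _ _).2 ?_
    rw [← ZMod.intCast_eq_intCast_iff_dvd_sub, ZMod.intCast_zmod_cast]
  have hFinj : Function.Injective F := by
    rintro ⟨c, i⟩ ⟨d, j⟩ h
    obtain rfl : c = d := by rw [← hcomp c i.cast, ← hcomp d j.cast]; exact congrArg _ h
    have := (hper c _ _).1 h
    rw [← ZMod.intCast_eq_intCast_iff_dvd_sub, ZMod.intCast_zmod_cast, ZMod.intCast_zmod_cast]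
      at this
    exact congrArg (Sigma.mk c) this
  have hFsurj : Function.Surjective F := by
    intro v
    have hr : G.Reachable (w (G.connectedComponentMk v) 0) v :=
      SimpleGraph.ConnectedComponent.exact (hwc _)
    generalize G.connectedComponentMk v = c at hr
    suffices ∃ i : ℤ, w c i = v by
      obtain ⟨i, hi⟩ := this
      exact ⟨⟨c, i⟩, (hF c i).trans hi⟩
    rw [SimpleGraph.reachable_iff_reflTransGen] at hr
    induction hr with
    | refl => exact ⟨0, rfl⟩
    | tail _ hbc ih =>
      obtain ⟨i, rfl⟩ := ih
      rcases ((hw c).adj_iff _ _).1 hbc with rfl | rfl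
      · exact ⟨_, rfl⟩
      · exact ⟨_, rfl⟩
  refine ⟨G.ConnectedComponent, inferInstance, n, hn,
    ⟨⟨Equiv.ofBijective F (And.intro hFinj hFsurj), ?_⟩⟩⟩
  rintro ⟨c, i⟩ ⟨d, j⟩
  obtain ⟨i, rfl⟩ := ZMod.intCast_surjective i
  obtain ⟨j, rfl⟩ := ZMod.intCast_surjective j
  have e1 : (cyclesFlow n).act 1 ⟨c, i⟩ = ⟨c, ((i + 1 : ℤ) : ZMod (n c))⟩ := by
    simp [cyclesFlow]
  have e2 : (cyclesFlow n).act 1 ⟨d, j⟩ = ⟨d, ((j + 1 : ℤ) : ZMod (n d))⟩ := by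
    simp [cyclesFlow]
  change G.Adj (F _) (F _) ↔ _
  rw [Flow.graph_adj, e1, e2,
    ← hFinj.ne_iff, ← hFinj.eq_iff, ← hFinj.eq_iff]
  simp only [hF]
  constructor
  · intro h
    refine ⟨h.ne, ?_⟩
    rcases ((hw c).adj_iff _ _).1 h with h' | h'
    · obtain rfl : d = c := by rw [← hcomp d j, h', hcomp]
      right
      rw [hper] at h' ⊢
      rw [show j + 1 - i = -(i - 1 - j) by ring]
      exact (Int.dvd_neg).2 h'
    · exact Or.inl h'
  · rintro ⟨-, h | h⟩
    · rw [h]; exact (hw c).adj i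
    · rw [h]; exact ((hw d).adj j).symm

/-! ### Majority families -/

/-- The two-element subsets of a triple. -/
def majority (x : Fin 3 → V) : Set (Set V) := {S | ∃ i j, i ≠ j ∧ S = {x i, x j}}

theorem inter_majority {x : Fin 3 → V} {S T : Set V} (hS : S ∈ majority x) (hT : T ∈ majority x) :
    (S ∩ T).Nonempty := by
  obtain ⟨a, b, hab, rfl⟩ := hS
  obtain ⟨c, d, hcd, rfl⟩ := hT
  have h : a = c ∨ a = d ∨ b = c ∨ b = d := by omega
  rcases h with rfl | rfl | rfl | rfl
  · exact ⟨x a, by simp⟩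
  · exact ⟨x a, by simp⟩
  · exact ⟨x b, by simp⟩
  · exact ⟨x b, by simp⟩

/-- The points of the triple are pairwise nonadjacent, without common neighbours. -/
structure IsScattered (G : SimpleGraph V) (x : Fin 3 → V) : Prop where
  not_adj : ∀ i j, ¬ G.Adj (x i) (x j)
  eq_of_adj : ∀ v i j, G.Adj v (x i) → G.Adj v (x j) → i = j

theorem IsScattered.act {φ : Flow V} {x : Fin 3 → V} (hφ : φ.IsCoaffine φ.graphᶜ)
    (h : IsScattered φ.graph x) (a : ℤ) : IsScattered φ.graph fun i => φ.act a (x i) := by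
  have key (v i) (hv : φ.graph.Adj v (φ.act a (x i))) : φ.graph.Adj (φ.act (-a) v) (x i) := by
    by_contra hc
    have := hφ.touch a _ _ (touch_compl.2 hc)
    rw [φ.act_neg, touch_compl] at this
    exact this hv
  refine ⟨fun i j hij => h.not_adj i j ?_, fun v i j hi hj => h.eq_of_adj _ i j (key _ _ hi)
    (key _ _ hj)⟩
  simpa [φ.neg_act] using key _ _ hij

theorem exists_ne_ne_of_unique {P : Fin 3 → Prop} (h : ∀ i j, P i → P j → i = j) :
    ∃ i j, i ≠ j ∧ ¬ P i ∧ ¬ P j := by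
  by_cases h0 : ∃ k, P k
  · obtain ⟨k, hk⟩ := h0
    obtain ⟨i, j, hij, hi, hj⟩ : ∃ i j : Fin 3, i ≠ j ∧ i ≠ k ∧ j ≠ k := by
      clear hk; revert k; decide
    exact ⟨i, j, hij, fun hc => hi (h _ _ hc hk), fun hc => hj (h _ _ hc hk)⟩
  · push Not at h0
    exact ⟨0, 1, by decide, h0 0, h0 1⟩

theorem IsScattered.exists_point {G : SimpleGraph V} {x : Fin 3 → V} (h : IsScattered G x)
    (v : V) : ∃ i j, i ≠ j ∧ Gᶜ.IsClique ({v} ∪ {x i, x j}) := by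
  obtain ⟨i, j, hij, hi, hj⟩ := exists_ne_ne_of_unique fun i j => h.eq_of_adj v i j
  refine ⟨i, j, hij, ?_⟩
  rw [isClique_iff_touch]
  simp only [Set.mem_union, Set.mem_singleton_iff, Set.mem_insert_iff, touch_compl]
  have hi' := fun h : G.Adj _ _ => hi h.symm
  have hj' := fun h : G.Adj _ _ => hj h.symm
  rintro _ (rfl | rfl | rfl) _ (rfl | rfl | rfl) <;>
    first
      | exact SimpleGraph.irrefl _
      | assumption
      | exact h.not_adj _ _

/-- Edges between two scattered triples form a matching. If it is not perfect, some `x i` has no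
neighbour among the `y k`; any second `x j` has at most one, which leaves two points of `y`. -/
theorem IsScattered.exists_pair {G : SimpleGraph V} {x y : Fin 3 → V} (hx : IsScattered G x)
    (hy : IsScattered G y)
    (h : ∀ c : Fin 3 → Fin 3, c.Injective → ¬ ∀ i, G.Adj (x i) (y (c i))) :
    ∃ i j k l, i ≠ j ∧ k ≠ l ∧ Gᶜ.IsClique ({x i, x j} ∪ {y k, y l}) := by
  obtain ⟨i, hi⟩ : ∃ i, ∀ k, ¬ G.Adj (x i) (y k) := by
    by_contra! hc
    choose c hc using hc
    exact h c (fun i j hij => hx.eq_of_adj _ i j (hc i).symm (hij ▸ (hc j).symm)) hc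
  obtain ⟨j, hj⟩ := exists_ne i
  obtain ⟨k, l, hkl, hk, hl⟩ := exists_ne_ne_of_unique fun k l => hy.eq_of_adj (x j) k l
  refine ⟨i, j, k, l, hj.symm, hkl, ?_⟩
  rw [isClique_iff_touch]
  simp only [Set.mem_union, Set.mem_singleton_iff, Set.mem_insert_iff, touch_compl]
  have hk' := fun h : G.Adj _ _ => hk h.symm
  have hl' := fun h : G.Adj _ _ => hl h.symm
  have hi' := fun k (h : G.Adj _ _) => hi k h.symm
  rintro _ ((rfl | rfl) | rfl | rfl) _ ((rfl | rfl) | rfl | rfl) <;>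
    first
      | exact hx.not_adj _ _
      | exact hy.not_adj _ _
      | assumption
      | exact hi _
      | exact hi' _

/-! ### Three or more cycles, or two cycles one of which is long -/

theorem cyclesFlow_adj {ι : Type*} {n : ι → ℕ} {x y : Σ c, ZMod (n c)}
    (h : (cyclesFlow n).graph.Adj x y) : x.1 = y.1 := by
  rcases h.2 with h | h
  · exact (congrArg Sigma.fst h).symm
  · exact (congrArg Sigma.fst h).trans rfl

theorem act_one_ne_of_ne_one {n : ℕ} (hn : n ≠ 1) (x : ZMod n) : x + 1 ≠ x := by
  have : Fact (n ≠ 1) := ⟨hn⟩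
  have : Nontrivial (ZMod n) := ZMod.nontrivial_iff.2 hn
  simp

theorem cyclesFlow_isCoaffine {ι : Type*} {n : ι → ℕ} (hn : ∀ c, 3 ≤ n c) :
    (cyclesFlow n).IsCoaffine (cyclesFlow n).graphᶜ := by
  refine Flow.isCoaffine _ fun x h => ?_
  obtain ⟨c, i⟩ := x
  have : i + ((1 : ℤ) : ZMod (n c)) = i := eq_of_heq (Sigma.mk.inj h).2
  exact act_one_ne_of_ne_one (by have := hn c; omega) i (by simpa using this)

theorem finite_cycles {ι : Type*} [Finite ι] {n : ι → ℕ} (hn : ∀ c, 3 ≤ n c) :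
    Finite (Σ c, ZMod (n c)) := by
  have (c : ι) : NeZero (n c) := ⟨by have := hn c; omega⟩
  infer_instance

theorem cycles_not_isBounded_of_three {ι : Type*} [Finite ι] {n : ι → ℕ} (hn : ∀ c, 3 ≤ n c)
    {c : Fin 3 → ι} (hc : c.Injective) : ¬ IsBounded (cyclesFlow n).graphᶜ := by
  have := finite_cycles hn
  have : Nonempty (Σ c, ZMod (n c)) := ⟨⟨c 0, 0⟩⟩
  refine not_isBounded_of_hasRank (m := 0)
    ⟨cyclesFlow n, cyclesFlow_isCoaffine hn, fun i => ⟨c i, 0⟩, fun i j hij a => ?_⟩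
  refine touch_compl.2 fun h => hij.ne (hc (cyclesFlow_adj h))

theorem eq_zero_of_intCast {n : ℕ} {k : ℤ} (h : (k : ZMod n) = 0) (hk : |k| < n) : k = 0 :=
  Int.eq_zero_of_abs_lt_dvd ((ZMod.intCast_zmod_eq_zero_iff_dvd _ _).1 h) hk

theorem cycles_not_isBounded_of_six_le {ι : Type*} [Finite ι] {n : ι → ℕ} (hn : ∀ c, 3 ≤ n c)
    {c d : ι} (hcd : c ≠ d) (hc : 6 ≤ n c) : ¬ IsBounded (cyclesFlow n).graphᶜ := by
  have := finite_cycles hn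
  have : Nonempty (Σ c, ZMod (n c)) := ⟨⟨c, 0⟩⟩
  have hφ := cyclesFlow_isCoaffine hn
  have hne : (⟨c, 0⟩ : Σ c, ZMod (n c)) ≠ ⟨d, 0⟩ := fun h => hcd (congrArg Sigma.fst h)
  -- Length at least 6 keeps 0 and 3 at distance 3, so the triple is scattered. The joined orbits
  -- come from its majority family and one singleton in each of the two cycles.
  let x : Fin 3 → Σ c, ZMod (n c) := ![⟨c, 0⟩, ⟨c, 3⟩, ⟨d, 0⟩]
  have mk_inj {i j : ZMod (n c)} (h : (⟨c, i⟩ : Σ c, ZMod (n c)) = ⟨c, j⟩) : i = j :=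
    eq_of_heq (Sigma.mk.inj h).2
  have adj {v : Σ c, ZMod (n c)} {i : ZMod (n c)} (h : (cyclesFlow n).graph.Adj v ⟨c, i⟩) :
      v = ⟨c, i + 1⟩ ∨ v = ⟨c, i - 1⟩ := by
    obtain ⟨b, j⟩ := v
    obtain rfl : b = c := cyclesFlow_adj h
    rcases h.2 with h | h
    · right
      rw [mk_inj h]
      simp
    · left
      rw [mk_inj h]
      simp
  have nz (k : ℕ) (hk : 0 < k) (hk' : k < 6) : (k : ZMod (n c)) ≠ 0 := by
    rw [Ne, ZMod.natCast_eq_zero_iff]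
    exact fun h => absurd (Nat.le_of_dvd hk h) (by omega)
  have h03 (v : Σ c, ZMod (n c)) (h0 : (cyclesFlow n).graph.Adj v ⟨c, 0⟩)
      (h3 : (cyclesFlow n).graph.Adj v ⟨c, 3⟩) : False := by
    rcases adj h0 with rfl | rfl <;> rcases adj h3 with h | h
    · exact nz 3 (by omega) (by omega) (by push_cast; linear_combination - mk_inj h)
    · exact nz 1 (by omega) (by omega) (by push_cast; linear_combination - mk_inj h)
    · exact nz 5 (by omega) (by omega) (by push_cast; linear_combination - mk_inj h)
    · exact nz 3 (by omega) (by omega) (by push_cast; linear_combination - mk_inj h)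
  have n03 : ¬ (cyclesFlow n).graph.Adj ⟨c, 0⟩ ⟨c, 3⟩ := by
    intro h
    rcases adj h with h | h
    · exact nz 4 (by omega) (by omega) (by push_cast; linear_combination - mk_inj h)
    · exact nz 2 (by omega) (by omega) (by push_cast; linear_combination - mk_inj h)
  have ncd (i j) : ¬ (cyclesFlow n).graph.Adj ⟨c, i⟩ ⟨d, j⟩ := fun h => hcd (cyclesFlow_adj h)
  have hx : IsScattered (cyclesFlow n).graph x := by
    refine ⟨fun i j h => ?_, fun v i j h h' => ?_⟩
    · fin_cases i <;> fin_cases j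
      · exact h.ne rfl
      · exact n03 h
      · exact ncd _ _ h
      · exact n03 h.symm
      · exact h.ne rfl
      · exact ncd _ _ h
      · exact ncd _ _ h.symm
      · exact ncd _ _ h.symm
      · exact h.ne rfl
    · have e := (cyclesFlow_adj h).symm.trans (cyclesFlow_adj h')
      fin_cases i <;> fin_cases j
      · rfl
      · exact (h03 v h h').elim
      · exact (hcd e).elim
      · exact (h03 v h' h).elim
      · rfl
      · exact (hcd e).elim
      · exact (hcd e.symm).elim
      · exact (hcd e.symm).elim
      · rfl
  refine not_isBounded_of_hasRank (m := 2) (IsJoinedFamily.hasRank hφ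
    (M := ![{{⟨c, 0⟩}}, {{⟨d, 0⟩}}, majority x]) ⟨fun i => ?_, fun i j hij a => ?_⟩)
  · fin_cases i
    · rintro S rfl T rfl; simp
    · rintro S rfl T rfl; simp
    · intro S hS T hT; exact inter_majority hS hT
  · have pt (v) : ∃ S ∈ ({{v}} : Set (Set (Σ c, ZMod (n c)))), ∃ T ∈ majority x,
        (cyclesFlow n).graphᶜ.IsClique (S ∪ (cyclesFlow n).act a '' T) := by
      obtain ⟨i, j, hij, h⟩ := (hx.act hφ a).exists_point v
      exact ⟨_, rfl, _, ⟨i, j, hij, rfl⟩, by rwa [Set.image_pair]⟩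
    have h3 : (i = 0 ∧ j = 1) ∨ (i = 0 ∧ j = 2) ∨ (i = 1 ∧ j = 2) := by omega
    rcases h3 with ⟨rfl, rfl⟩ | ⟨rfl, rfl⟩ | ⟨rfl, rfl⟩
    · refine ⟨_, rfl, _, rfl, ?_⟩
      rw [Set.image_singleton, Set.singleton_union, SimpleGraph.isClique_pair]
      exact fun h => (touch_compl.2 (ncd _ _)).resolve_left h
    · exact pt _
    · exact pt _

/-! ### Long cycles -/

/-- Rotation of a cycle. -/
def cycleFlow (n : ℕ) : Flow (ZMod n) where
  act a x := x + a
  zero x := by simp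
  add a b x := by push_cast; ring

/-- Simultaneous rotation of two cycles. -/
def pairFlow (m n : ℕ) : Flow (ZMod m ⊕ ZMod n) where
  act a := Sum.map (· + (a : ZMod m)) (· + (a : ZMod n))
  zero x := by cases x <;> simp
  add a b x := by cases x <;> simp [add_comm, add_left_comm]

theorem cycleFlow_isCoaffine {n : ℕ} (hn : n ≠ 1) :
    (cycleFlow n).IsCoaffine (cycleFlow n).graphᶜ :=
  Flow.isCoaffine _ fun x h => act_one_ne_of_ne_one hn x (by simpa [cycleFlow] using h)

theorem pairFlow_isCoaffine {m n : ℕ} (hm : m ≠ 1) (hn : n ≠ 1) :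
    (pairFlow m n).IsCoaffine (pairFlow m n).graphᶜ := by
  refine Flow.isCoaffine _ fun x h => ?_
  rcases x with x | x
  · exact act_one_ne_of_ne_one hm x (by simpa [pairFlow] using h)
  · exact act_one_ne_of_ne_one hn x (by simpa [pairFlow] using h)

theorem cycleFlow_adj {n : ℕ} {i j : ℤ} (h : (cycleFlow n).graph.Adj i j) :
    ∃ b : Bool, ((j - i - (if b then 1 else -1) : ℤ) : ZMod n) = 0 := by
  rcases h.2 with h | h
  · refine ⟨true, ?_⟩
    push_cast
    rw [h]
    simp [cycleFlow]
  · refine ⟨false, ?_⟩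
    push_cast
    rw [h]
    simp [cycleFlow]

theorem cycleFlow_adj_add {n : ℕ} {a : ZMod n} {i j : ℤ}
    (h : (cycleFlow n).graph.Adj i (j + a)) :
    ∃ b : Bool, a = ((i - j + (if b then 1 else -1) : ℤ) : ZMod n) := by
  obtain ⟨a, rfl⟩ := ZMod.intCast_surjective a
  obtain ⟨b, hb⟩ := cycleFlow_adj (j := j + a) (by exact_mod_cast h)
  exact ⟨b, by push_cast at hb ⊢; linear_combination hb⟩

/-- An integer of absolute value below `n` vanishes modulo `n` only if it is 0; so finitely many
integer checks serve all large `n`. -/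
theorem isScattered_cycle {n : ℕ} {x : Fin 3 → ℤ}
    (h : ∀ i j, |x j - x i - 1| < n ∧ x j - x i ≠ 1)
    (h' : ∀ i j, i ≠ j → ∀ b b' : Bool,
      |x j - x i + (if b then 1 else -1) - (if b' then 1 else -1)| < n ∧
      x j - x i + (if b then 1 else -1) - (if b' then 1 else -1) ≠ 0) :
    IsScattered (cycleFlow n).graph fun i => (x i : ZMod n) := by
  have key (i j) (h1 : ((x j - x i - 1 : ℤ) : ZMod n) = 0) : False :=
    (h i j).2 (by linarith [eq_zero_of_intCast h1 (h i j).1])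
  refine ⟨fun i j hij => ?_, fun v i j hi hj => ?_⟩
  · rcases hij.2 with e | e
    · exact key i j (by push_cast; rw [e]; simp [cycleFlow])
    · exact key j i (by push_cast; rw [e]; simp [cycleFlow])
  · by_contra hij
    obtain ⟨v, rfl⟩ := ZMod.intCast_surjective v
    obtain ⟨b, hb⟩ := cycleFlow_adj hi
    obtain ⟨b', hb'⟩ := cycleFlow_adj hj
    refine (h' i j hij b b').2 (eq_zero_of_intCast ?_ (h' i j hij b b').1)
    push_cast at hb hb' ⊢
    linear_combination hb' - hb

/-- Two scattered triples with different gaps and a singleton give three joined orbits. -/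
theorem cycle_hasRank {n : ℕ} (hn : 2 ≤ n) {x y : Fin 3 → ℤ}
    (hx : IsScattered (cycleFlow n).graph fun i => (x i : ZMod n))
    (hy : IsScattered (cycleFlow n).graph fun i => (y i : ZMod n))
    (hxy : ∀ c : Fin 3 → Fin 3, (∀ i j, c i = c j → i = j) → ∀ b : Fin 3 → Bool, ∃ i j,
      |(x i - y (c i) + (if b i then 1 else -1)) - (x j - y (c j) + (if b j then 1 else -1))| < n ∧
      (x i - y (c i) + (if b i then 1 else -1)) - (x j - y (c j) + (if b j then 1 else -1)) ≠ 0) :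
    HasRank (cliqueGraph (cliqueGraph (cycleFlow n).graphᶜ)) 3 := by
  have : NeZero n := ⟨by omega⟩
  have hφ := cycleFlow_isCoaffine (n := n) (by omega)
  refine IsJoinedFamily.hasRank hφ
    (M := ![{{0}}, majority fun i => (x i : ZMod n), majority fun i => (y i : ZMod n)])
    ⟨fun i => ?_, fun i j hij a => ?_⟩
  · fin_cases i
    · rintro S rfl T rfl; simp
    · intro S hS T hT; exact inter_majority hS hT
    · intro S hS T hT; exact inter_majority hS hT
  · have h3 : (i = 0 ∧ j = 1) ∨ (i = 0 ∧ j = 2) ∨ (i = 1 ∧ j = 2) := by omega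
    rcases h3 with ⟨rfl, rfl⟩ | ⟨rfl, rfl⟩ | ⟨rfl, rfl⟩
    · obtain ⟨k, l, hkl, h⟩ := (hx.act hφ a).exists_point 0
      exact ⟨_, rfl, _, ⟨k, l, hkl, rfl⟩, by rwa [Set.image_pair]⟩
    · obtain ⟨k, l, hkl, h⟩ := (hy.act hφ a).exists_point 0
      exact ⟨_, rfl, _, ⟨k, l, hkl, rfl⟩, by rwa [Set.image_pair]⟩
    -- A perfect matching `c` with the translate by `a` would give `a = x i - y (c i) ± 1` for all
    -- `i`; by `hxy` two of these values differ modulo `n`.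
    · obtain ⟨i, j, k, l, hij, hkl, h⟩ := hx.exists_pair (hy.act hφ a) (fun c hc h => by
        choose b hb using fun i => cycleFlow_adj_add (h i)
        obtain ⟨i, j, h1, h2⟩ := hxy c (fun i j => @hc i j) b
        refine h2 (eq_zero_of_intCast ?_ h1)
        rw [Int.cast_sub, ← hb i, ← hb j, sub_self])
      exact ⟨_, ⟨i, j, hij, rfl⟩, _, ⟨k, l, hkl, rfl⟩, by rwa [Set.image_pair]⟩

theorem cycle_hasRank_of_thirteen_le {n : ℕ} (hn : 13 ≤ n) :
    HasRank (cliqueGraph (cliqueGraph (cycleFlow n).graphᶜ)) 3 := by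
  have hn' : (13 : ℤ) ≤ n := by exact_mod_cast hn
  refine cycle_hasRank (by omega) (x := ![0, 3, 6]) (y := ![0, 3, 7])
    (isScattered_cycle ?_ ?_) (isScattered_cycle ?_ ?_) ?_
  · have : ∀ i j : Fin 3, |(![0, 3, 6] : Fin 3 → ℤ) j - ![0, 3, 6] i - 1| < 13 ∧
      (![0, 3, 6] : Fin 3 → ℤ) j - ![0, 3, 6] i ≠ 1 := by decide
    exact fun i j => ⟨(this i j).1.trans_le hn', (this i j).2⟩
  · have : ∀ i j : Fin 3, i ≠ j → ∀ b b' : Bool, |(![0, 3, 6] : Fin 3 → ℤ) j - ![0, 3, 6] i +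
      (if b then 1 else -1) - (if b' then 1 else -1)| < 13 ∧ (![0, 3, 6] : Fin 3 → ℤ) j -
      ![0, 3, 6] i + (if b then 1 else -1) - (if b' then 1 else -1) ≠ 0 := by decide
    exact fun i j h b b' => ⟨(this i j h b b').1.trans_le hn', (this i j h b b').2⟩
  · have : ∀ i j : Fin 3, |(![0, 3, 7] : Fin 3 → ℤ) j - ![0, 3, 7] i - 1| < 13 ∧
      (![0, 3, 7] : Fin 3 → ℤ) j - ![0, 3, 7] i ≠ 1 := by decide
    exact fun i j => ⟨(this i j).1.trans_le hn', (this i j).2⟩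
  · have : ∀ i j : Fin 3, i ≠ j → ∀ b b' : Bool, |(![0, 3, 7] : Fin 3 → ℤ) j - ![0, 3, 7] i +
      (if b then 1 else -1) - (if b' then 1 else -1)| < 13 ∧ (![0, 3, 7] : Fin 3 → ℤ) j -
      ![0, 3, 7] i + (if b then 1 else -1) - (if b' then 1 else -1) ≠ 0 := by decide
    exact fun i j h b b' => ⟨(this i j h b b').1.trans_le hn', (this i j h b b').2⟩
  · have : ∀ c : Fin 3 → Fin 3, (∀ i j, c i = c j → i = j) → ∀ b : Fin 3 → Bool, ∃ i j,
      |((![0, 3, 6] : Fin 3 → ℤ) i - ![0, 3, 7] (c i) + (if b i then 1 else -1)) -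
        (![0, 3, 6] j - ![0, 3, 7] (c j) + (if b j then 1 else -1))| < 13 ∧
      ((![0, 3, 6] : Fin 3 → ℤ) i - ![0, 3, 7] (c i) + (if b i then 1 else -1)) -
        (![0, 3, 6] j - ![0, 3, 7] (c j) + (if b j then 1 else -1)) ≠ 0 := by decide +kernel
    intro c hc b
    obtain ⟨i, j, h1, h2⟩ := this c hc b
    exact ⟨i, j, h1.trans_le hn', h2⟩

/-! ### Certificates for small graphs -/

/-- Any two entries of the lists are related. -/
def IsCompatible {I : Type*} (R : I → I → Prop) (S T : List I) : Prop :=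
  ∀ p ∈ S ++ T, ∀ q ∈ S ++ T, R p q

instance {I : Type*} (R : I → I → Prop) [DecidableRel R] (S T : List I) :
    Decidable (IsCompatible R S T) :=
  inferInstanceAs (Decidable (∀ p ∈ S ++ T, ∀ q ∈ S ++ T, R p q))

/-- Families of lists with the properties of a joined family. -/
def IsCertificate {I : Type*} (ψ : Flow I) (m : ℕ) (R : I → I → Prop) {k : ℕ}
    (F : Fin k → List (List I)) : Prop :=
  (∀ i, ∀ S ∈ F i, ∀ T ∈ F i, ∃ p ∈ S, p ∈ T) ∧
    ∀ i j, i < j → ∀ a : Fin m, ∃ S ∈ F i, ∃ T ∈ F j, IsCompatible R S (T.map (ψ.act (a : ℕ)))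

instance {I : Type*} [DecidableEq I] (ψ : Flow I) (m : ℕ) (R : I → I → Prop) [DecidableRel R]
    {k : ℕ} (F : Fin k → List (List I)) : Decidable (IsCertificate ψ m R F) :=
  inferInstanceAs (Decidable (_ ∧ _))

/-- Finite data, indexed by `I` with an action of period `m`, that give joined families. -/
theorem hasRank_of_certificate {I : Type*} [Finite V] [Nonempty V] {G : SimpleGraph V}
    {φ : Flow V} (hφ : φ.IsCoaffine G) (ψ : Flow I) (f : I → V)
    (hf : ∀ p, f (ψ.act 1 p) = φ.act 1 (f p)) {m k : ℕ} (hm : 0 < m) (hψ : ∀ p, ψ.act m p = p)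
    (R : I → I → Prop) (hR : ∀ p q, R p q → Touch G (f p) (f q))
    (F : Fin k → List (List I)) (hF : IsCertificate ψ m R F) :
    HasRank (cliqueGraph (cliqueGraph G)) k := by
  have hf' (a : ℤ) (p : I) : f (ψ.act a p) = φ.act a (f p) := by
    induction a using Int.induction_on generalizing p with
    | zero => rw [ψ.zero, φ.zero]
    | succ a ih => rw [ψ.add, φ.add, ih, hf]
    | pred a ih =>
      have h1 (p : I) : f (ψ.act (-1) p) = φ.act (-1) (f p) := by
        rw [← φ.neg_act 1 (f (ψ.act (-1) p)), ← hf, ψ.act_neg]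
      rw [sub_eq_add_neg, ψ.add, φ.add, ih, h1]
  have hper (t : ℤ) (p : I) : ψ.act (m * t) p = p := by
    induction t using Int.induction_on generalizing p with
    | zero => rw [mul_zero, ψ.zero]
    | succ t ih => rw [mul_add, mul_one, ψ.add, hψ, ih]
    | pred t ih =>
      have h1 : ψ.act (-m) p = p := by
        rw [← congrArg (ψ.act (-m)) (hψ p), ψ.neg_act]
      rw [mul_sub, mul_one, sub_eq_add_neg, ψ.add, h1, ih]
  refine IsJoinedFamily.hasRank hφ (M := fun i => {S | ∃ L ∈ F i, S = f '' {p | p ∈ L}})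
    ⟨?_, fun i j hij a => ?_⟩
  · rintro i _ ⟨S, hS, rfl⟩ _ ⟨T, hT, rfl⟩
    obtain ⟨p, hp, hp'⟩ := hF.1 i S hS T hT
    exact ⟨f p, ⟨p, hp, rfl⟩, ⟨p, hp', rfl⟩⟩
  · have hm' : (0 : ℤ) < m := by exact_mod_cast hm
    -- The action on labels has period `m`, so the translates by `0, ..., m - 1` are all of them.
    obtain ⟨r, hr⟩ : ∃ r : Fin m, ((r : ℕ) : ℤ) = a % m := by
      have h0 := Int.emod_nonneg a hm'.ne'
      have h1 := Int.emod_lt_of_pos a hm'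
      exact ⟨⟨(a % m).toNat, by omega⟩, by simp [h0]⟩
    obtain ⟨S, hS, T, hT, hST⟩ := hF.2 i j hij r
    refine ⟨_, ⟨S, hS, rfl⟩, _, ⟨T, hT, rfl⟩, ?_⟩
    have himg : φ.act a '' (f '' {p | p ∈ T}) = f '' {p | p ∈ T.map (ψ.act (r : ℕ))} := by
      ext v
      simp only [Set.mem_image, Set.mem_ofPred_eq, List.mem_map, exists_exists_and_eq_and]
      refine exists_congr fun p => and_congr_right fun _ => ?_
      have : ψ.act a p = ψ.act (r : ℕ) p := by
        conv_lhs => rw [← Int.emod_add_mul_ediv a m, ψ.add, hper, ← hr]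
      rw [← hf', this]
    rw [himg, ← Set.image_union, isClique_iff_touch]
    rintro _ ⟨p, hp, rfl⟩ _ ⟨q, hq, rfl⟩
    refine hR p q (hST p ?_ q ?_)
    · simpa using hp
    · simpa using hq

/-- Certificates one level higher, given by maximal cliques of the complement of `φ.graph`. -/
theorem hasRank_of_clique_certificate {I : Type*} [DecidableEq V] [Finite V] [Nonempty V]
    {φ : Flow V} (hφ : φ.IsCoaffine φ.graphᶜ) (ψ : Flow I) (A : I → Finset V)
    (hA : ∀ p, ∀ v ∈ A p, ∀ w ∈ A p, ¬ φ.graph.Adj v w)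
    (hA' : ∀ p v, (∀ w ∈ A p, ¬ φ.graph.Adj v w) → v ∈ A p)
    (hf : ∀ p, A (ψ.act 1 p) = (A p).image (φ.act 1)) {m k : ℕ} (hm : 0 < m)
    (hψ : ∀ p, ψ.act m p = p)
    (F : Fin k → List (List I)) (hF : IsCertificate ψ m (fun p q => (A p ∩ A q).Nonempty) F) :
    HasRank (cliqueGraph (cliqueGraph (cliqueGraph φ.graphᶜ))) k := by
  refine hasRank_of_certificate hφ.cliqueGraph ψ
    (fun p => ⟨A p, isMaxClique_iff.2 ⟨fun v hv w hw => touch_compl.2 (hA p v hv w hw),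
      fun v hv => hA' p v fun w hw => touch_compl.1 (hv w hw)⟩⟩)
    (fun p => Subtype.ext ?_) hm hψ (fun p q => (A p ∩ A q).Nonempty) (fun p q => ?_) F hF
  · simp [hf, Flow.cliqueFlow]
  · rintro ⟨v, hv⟩
    exact touch_of_inter ⟨v, (Finset.mem_inter.1 hv).1, (Finset.mem_inter.1 hv).2⟩

/-! ### Explicit certificates and retractions -/

/-- Up to rotation, `C₁₀` has only one scattered triple (gaps 3, 3, 4), so larger independent sets
are used. -/
theorem hasRank_cycle_ten : HasRank (cliqueGraph (cliqueGraph (cycleFlow 10).graphᶜ)) 3 :=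
  hasRank_of_certificate (cycleFlow_isCoaffine (by omega)) (cycleFlow 10) id (fun _ => rfl)
    (m := 10) (by omega) (by decide +kernel) (fun p q => ¬ (cycleFlow 10).graph.Adj p q)
    (fun _ _ => touch_compl.2)
    ![[[2, 5, 7, 9], [0, 2, 4, 7], [0, 2, 5, 8], [0, 3, 5, 7]],
      [[0, 2, 4, 6, 8], [0, 2, 5, 8], [0, 3, 6, 8], [2, 4, 6, 9]],
      [[0, 2, 4, 6, 8], [1, 3, 5, 8], [1, 3, 6, 9], [2, 5, 7, 9]]]
    (by decide +kernel)

theorem hasRank_cycle_eleven : HasRank (cliqueGraph (cliqueGraph (cycleFlow 11).graphᶜ)) 3 :=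
  hasRank_of_certificate (cycleFlow_isCoaffine (by omega)) (cycleFlow 11) id (fun _ => rfl)
    (m := 11) (by omega) (by decide +kernel) (fun p q => ¬ (cycleFlow 11).graph.Adj p q)
    (fun _ _ => touch_compl.2)
    ![[[0]], [[0, 3], [0, 6], [3, 6]], [[0, 3], [0, 7], [3, 7]]]
    (by decide +kernel)

/-- The triple `{0, 3, 7}` would fail here: its translate `{4, 7, 11}` is perfectly matched with
`{0, 3, 6}`. -/
theorem hasRank_cycle_twelve : HasRank (cliqueGraph (cliqueGraph (cycleFlow 12).graphᶜ)) 3 :=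
  hasRank_of_certificate (cycleFlow_isCoaffine (by omega)) (cycleFlow 12) id (fun _ => rfl)
    (m := 12) (by omega) (by decide +kernel) (fun p q => ¬ (cycleFlow 12).graph.Adj p q)
    (fun _ _ => touch_compl.2)
    ![[[0]], [[0, 3], [0, 6], [3, 6]], [[0, 4], [0, 8], [4, 8]]]
    (by decide +kernel)

theorem hasRank_pair_five_five :
    HasRank (cliqueGraph (cliqueGraph (pairFlow 5 5).graphᶜ)) 3 :=
  hasRank_of_certificate (pairFlow_isCoaffine (by omega) (by omega)) (pairFlow 5 5) id
    (fun _ => rfl) (m := 5) (by omega) (by decide +kernel)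
    (fun p q => ¬ (pairFlow 5 5).graph.Adj p q) (fun _ _ => touch_compl.2)
    ![[[.inl 2, .inl 4, .inr 0, .inr 3], [.inl 0, .inl 2, .inr 2, .inr 4],
        [.inl 0, .inl 3, .inr 0, .inr 2], [.inl 0, .inl 3, .inr 1, .inr 3]],
      [[.inl 0, .inl 3, .inr 1, .inr 4], [.inl 0, .inl 2, .inr 1, .inr 3],
        [.inl 0, .inl 2, .inr 2, .inr 4], [.inl 2, .inl 4, .inr 1, .inr 4]],
      [[.inl 0, .inl 2, .inr 0, .inr 3], [.inl 0, .inl 2, .inr 1, .inr 3],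
        [.inl 0, .inl 3, .inr 0, .inr 2], [.inl 1, .inl 3, .inr 0, .inr 3],
        [.inl 2, .inl 4, .inr 0, .inr 2]]]
    (by decide +kernel)

/-- The sets `{i, i + 2, i + 4, i + 6}` and `{i, i + 3, i + 6}`, which are the maximal independent
sets of the 8-cycle. -/
def octagonCliques : ZMod 8 ⊕ ZMod 8 → Finset (ZMod 8)
  | .inl i => {i, i + 2, i + 4, i + 6}
  | .inr i => {i, i + 3, i + 6}

/-- A scattered triple needs three gaps of at least 3, which `C₈` cannot provide; the certificate
lives in the clique graph. The labels `.inl i` and `.inl (i + 2)` name the same set. -/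
theorem hasRank_cycle_eight :
    HasRank (cliqueGraph (cliqueGraph (cliqueGraph (cycleFlow 8).graphᶜ))) 3 :=
  hasRank_of_clique_certificate (cycleFlow_isCoaffine (by omega)) (pairFlow 8 8) octagonCliques
    (by decide +kernel) (by decide +kernel) (by decide +kernel) (m := 8) (by omega)
    (by decide +kernel)
    ![[[.inl 0, .inr 2, .inr 4, .inr 7], [.inl 0, .inr 5, .inr 0, .inr 3],
        [.inl 0, .inr 3, .inr 6, .inr 1], [.inl 0, .inr 6, .inr 1, .inr 4]],
      [[.inl 0, .inr 2, .inr 5, .inr 0], [.inl 0, .inr 2, .inr 5, .inr 7],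
        [.inl 0, .inr 5, .inr 0, .inr 3], [.inr 2, .inr 5, .inr 0, .inl 1], [.inr 2, .inr 5, .inl 1, .inr 7]],
      [[.inl 0, .inr 2, .inr 5, .inr 0], [.inr 2, .inl 1, .inr 4, .inr 7],
        [.inr 0, .inl 1, .inr 3, .inr 6], [.inl 0, .inr 6, .inr 1, .inr 4]]]
    (by decide +kernel)

/-- Maximal independent sets of the disjoint union of an edge and a 5-cycle, indexed by the vertices
of a 10-cycle. -/
def suspensionCliques (i : ZMod 10) : Finset (ZMod 2 ⊕ ZMod 5) :=
  {.inl i.cast, .inr i.cast, .inr (i.cast + 2)}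

/-- The sets with indices `i` and `j` are disjoint exactly when `j - i = ±1`. Their intersection
graph is thus the complement of `C₁₀`, and the lists are those of `hasRank_cycle_ten`. -/
theorem hasRank_suspension :
    HasRank (cliqueGraph (cliqueGraph (cliqueGraph (pairFlow 2 5).graphᶜ))) 3 :=
  hasRank_of_clique_certificate (pairFlow_isCoaffine (by omega) (by omega)) (cycleFlow 10)
    suspensionCliques
    (by decide +kernel) (by decide +kernel) (by decide +kernel) (m := 10) (by omega)
    (by decide +kernel)
    ![[[2, 5, 7, 9], [0, 2, 4, 7], [0, 2, 5, 8], [0, 3, 5, 7]],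
      [[0, 2, 4, 6, 8], [0, 2, 5, 8], [0, 3, 6, 8], [2, 4, 6, 9]],
      [[0, 2, 4, 6, 8], [1, 3, 5, 8], [1, 3, 6, 9], [2, 5, 7, 9]]]
    (by decide +kernel)

/-- Folds the first cycle onto an edge, which requires the two fibres of `g` to be completely joined
in the cycle: `{0, 2}` and `{1}` for `m = 3`, `{0, 2}` and `{1, 3}` for `m = 4`. -/
theorem pair_not_isBounded_of_retraction {m : ℕ} [NeZero m] (f : ZMod 2 → ZMod m)
    (g : ZMod m → ZMod 2)
    (hf : ∀ x y, (pairFlow m 5).graph.Adj (Sum.map f id x) (Sum.map f id y) →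
      (pairFlow 2 5).graph.Adj x y)
    (hg : ∀ x y, (pairFlow 2 5).graph.Adj (Sum.map g id x) (Sum.map g id y) →
      (pairFlow m 5).graph.Adj x y)
    (hgf : ∀ x, g (f x) = x) : ¬ IsBounded (pairFlow m 5).graphᶜ := by
  have h : IsRetract (pairFlow 2 5).graphᶜ (pairFlow m 5).graphᶜ := by
    refine ⟨Sum.map f id, Sum.map g id, fun x y => ?_, fun x y => ?_, fun x => ?_⟩
    · rw [touch_compl, touch_compl]; exact mt (hf x y)
    · rw [touch_compl, touch_compl]; exact mt (hg x y)
    · cases x <;> simp [hgf]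
  exact fun hb => not_isBounded_of_hasRank (m := 3) hasRank_suspension (h.isBounded hb)

theorem pair_three_five_not_isBounded : ¬ IsBounded (pairFlow 3 5).graphᶜ :=
  pair_not_isBounded_of_retraction (fun i => (i.val : ZMod 3)) (fun i => (i.val : ZMod 2))
    (by decide +kernel) (by decide +kernel) (by decide +kernel)

theorem pair_four_five_not_isBounded : ¬ IsBounded (pairFlow 4 5).graphᶜ :=
  pair_not_isBounded_of_retraction (fun i => (i.val : ZMod 4)) (fun i => (i.val : ZMod 2))
    (by decide +kernel) (by decide +kernel) (by decide +kernel)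

theorem pair_five_five_not_isBounded : ¬ IsBounded (pairFlow 5 5).graphᶜ :=
  not_isBounded_of_hasRank (m := 2) hasRank_pair_five_five

/-- The complement of the 9-cycle retracts onto the octahedron. -/
theorem cycle_nine_not_isBounded : ¬ IsBounded (cycleFlow 9).graphᶜ := by
  let φ : Flow (Fin 3 × ZMod 2) :=
    { act a x := (x.1, x.2 + a)
      zero x := by simp
      add a b x := by simp [add_comm, add_left_comm] }
  have hφ : φ.IsCoaffine φ.graphᶜ := Flow.isCoaffine _ (by decide +kernel)
  have hrank : HasRank φ.graphᶜ 3 := by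
    refine ⟨φ, hφ, fun i => (i, 0), fun i j hij a => touch_compl.2 fun h => ?_⟩
    rcases h.2 with h | h
    · exact hij.ne (congrArg Prod.fst h).symm
    · exact hij.ne (congrArg Prod.fst h)
  -- Cut the cycle into three blocks of three consecutive vertices; in each block the two ends are
  -- identified and the middle vertex becomes their antipode.
  have hret : IsRetract φ.graphᶜ (cycleFlow 9).graphᶜ := by
    refine ⟨fun x => ((3 * x.1.val + x.2.val : ℕ) : ZMod 9),
      fun i => (Fin.ofNat 3 (i.val / 3), ((i.val % 3 : ℕ) : ZMod 2)), fun x y => ?_, fun x y => ?_,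
      by decide +kernel⟩
    · rw [touch_compl, touch_compl]; revert x y; decide +kernel
    · rw [touch_compl, touch_compl]; revert x y; decide +kernel
  exact fun hb => not_isBounded_of_hasRank (m := 0) hrank (hret.isBounded hb)

theorem cycle_not_isBounded {n : ℕ} (hn : 8 ≤ n) : ¬ IsBounded (cycleFlow n).graphᶜ := by
  by_cases h13 : 13 ≤ n
  · have : NeZero n := ⟨by omega⟩
    exact not_isBounded_of_hasRank (m := 2) (cycle_hasRank_of_thirteen_le h13)
  · obtain rfl | rfl | rfl | rfl | rfl : n = 8 ∨ n = 9 ∨ n = 10 ∨ n = 11 ∨ n = 12 := by omega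
    · exact not_isBounded_of_hasRank (m := 3) hasRank_cycle_eight
    · exact cycle_nine_not_isBounded
    · exact not_isBounded_of_hasRank (m := 2) hasRank_cycle_ten
    · exact not_isBounded_of_hasRank (m := 2) hasRank_cycle_eleven
    · exact not_isBounded_of_hasRank (m := 2) hasRank_cycle_twelve

/-! ### The cases that satisfy the Helly criterion -/

theorem cycle_hellyCriterion {n : ℕ} (hn : 3 ≤ n) (hn' : n < 8) :
    HellyCriterion (cycleFlow n).graph := by
  obtain rfl | rfl | rfl | rfl | rfl : n = 3 ∨ n = 4 ∨ n = 5 ∨ n = 6 ∨ n = 7 := by omega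
  all_goals decide +kernel

theorem pair_three_three_hellyCriterion : HellyCriterion (pairFlow 3 3).graph := by
  decide +kernel

theorem pair_three_four_hellyCriterion : HellyCriterion (pairFlow 3 4).graph := by
  decide +kernel

theorem pair_four_four_hellyCriterion : HellyCriterion (pairFlow 4 4).graph := by
  decide +kernel

theorem pair_isBounded_or_helly {m n : ℕ} (hm : 3 ≤ m) (hmn : m ≤ n) (hn : n < 6) :
    ¬ IsBounded (pairFlow m n).graphᶜ ∨ HellyCriterion (pairFlow m n).graph := by
  obtain rfl | rfl | rfl : m = 3 ∨ m = 4 ∨ m = 5 := by omega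
  · obtain rfl | rfl | rfl : n = 3 ∨ n = 4 ∨ n = 5 := by omega
    · exact Or.inr pair_three_three_hellyCriterion
    · exact Or.inr pair_three_four_hellyCriterion
    · exact Or.inl pair_three_five_not_isBounded
  · obtain rfl | rfl : n = 4 ∨ n = 5 := by omega
    · exact Or.inr pair_four_four_hellyCriterion
    · exact Or.inl pair_four_five_not_isBounded
  · obtain rfl : n = 5 := by omega
    exact Or.inl pair_five_five_not_isBounded

/-! ### All 2-regular graphs -/

theorem exists_iso_cycle {ι : Type*} {n : ι → ℕ} {c : ι} (h : ∀ d, d = c) :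
    Nonempty ((cycleFlow (n c)).graph ≃g (cyclesFlow n).graph) := by
  have hb : Function.Bijective fun i => (⟨c, i⟩ : Σ c, ZMod (n c)) := by
    refine ⟨fun i j hij => eq_of_heq (Sigma.mk.inj hij).2, ?_⟩
    rintro ⟨d, i⟩
    obtain rfl := h d
    exact ⟨i, rfl⟩
  exact ⟨Flow.isoOfEquiv (Equiv.ofBijective _ hb) fun _ => rfl⟩

theorem exists_iso_pair {ι : Type*} {n : ι → ℕ} {c d : ι} (hcd : c ≠ d)
    (h : ∀ e, e = c ∨ e = d) :
    Nonempty ((pairFlow (n c) (n d)).graph ≃g (cyclesFlow n).graph) := by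
  let f : ZMod (n c) ⊕ ZMod (n d) → Σ c, ZMod (n c) :=
    Sum.elim (fun i => ⟨c, i⟩) fun i => ⟨d, i⟩
  have hb : f.Bijective := by
    constructor
    · rintro (i | i) (j | j) hij
      · exact congrArg _ (eq_of_heq (Sigma.mk.inj hij).2)
      · exact absurd (congrArg Sigma.fst hij) hcd
      · exact absurd (congrArg Sigma.fst hij).symm hcd
      · exact congrArg _ (eq_of_heq (Sigma.mk.inj hij).2)
    · rintro ⟨e, i⟩
      rcases h e with rfl | rfl
      · exact ⟨.inl i, rfl⟩
      · exact ⟨.inr i, rfl⟩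
  exact ⟨Flow.isoOfEquiv (Equiv.ofBijective f hb) fun x => by cases x <;> rfl⟩

theorem cycles_isBounded_or_helly {ι : Type*} [Finite ι] [Nonempty ι] {n : ι → ℕ}
    (hn : ∀ c, 3 ≤ n c) :
    ¬ IsBounded (cyclesFlow n).graphᶜ ∨ HellyCriterion (cyclesFlow n).graph := by
  have := finite_cycles hn
  have (c : ι) : NeZero (n c) := ⟨by have := hn c; omega⟩
  obtain ⟨c⟩ := ‹Nonempty ι›
  by_cases h1 : ∀ d, d = c
  · obtain ⟨e⟩ := exists_iso_cycle (n := n) h1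
    by_cases h8 : n c < 8
    · exact Or.inr ((cycle_hellyCriterion (hn c) h8).of_iso e)
    · exact Or.inl fun h => cycle_not_isBounded (not_lt.1 h8)
        ((isRetract_compl_of_iso e).isBounded h)
  push Not at h1
  obtain ⟨d, hdc⟩ := h1
  by_cases h2 : ∀ e, e = c ∨ e = d
  · have main {c d : ι} (hcd : c ≠ d) (h2 : ∀ e, e = c ∨ e = d) (hle : n c ≤ n d) :
        ¬ IsBounded (cyclesFlow n).graphᶜ ∨ HellyCriterion (cyclesFlow n).graph := by
      by_cases h6 : n d < 6
      · obtain ⟨e⟩ := exists_iso_pair (n := n) hcd h2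
        refine (pair_isBounded_or_helly (hn c) hle h6).imp (fun h hb => ?_) fun h => h.of_iso e
        exact h ((isRetract_compl_of_iso e).isBounded hb)
      · exact Or.inl (cycles_not_isBounded_of_six_le hn hcd.symm (not_lt.1 h6))
    rcases le_total (n c) (n d) with h | h
    · exact main hdc.symm h2 h
    · exact main hdc (fun e => (h2 e).symm) h
  · push Not at h2
    obtain ⟨e, hec, hed⟩ := h2
    refine Or.inl (cycles_not_isBounded_of_three hn (c := ![c, d, e]) ?_)
    intro i j hij
    fin_cases i <;> fin_cases j <;> simp_all

theorem isConvergent_compl_iff_isHelly {V : Type u} [Fintype V] {G : SimpleGraph V}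
    [DecidableRel G.Adj] (hG : G.IsRegularOfDegree 2) : IsConvergent Gᶜ ↔ IsHelly Gᶜ := by
  refine ⟨fun h => ?_, fun h => h.isBounded.isConvergent⟩
  rcases isEmpty_or_nonempty V with hV | hV
  · exact isHelly_of_isEmpty _
  obtain ⟨ι, _, n, hn, ⟨e⟩⟩ := exists_iso_cycles hG
  have := finite_cycles hn
  have : Nonempty ι := hV.map fun v => (e.symm v).1
  rcases cycles_isBounded_or_helly hn with h' | h'
  · exact absurd ((isRetract_compl_of_iso e).isBounded h.isBounded) h'
  · exact (h'.of_iso e).isHelly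

instance decidableRelSum {G : SimpleGraph V} {H : SimpleGraph W} [DecidableRel G.Adj]
    [DecidableRel H.Adj] : DecidableRel (G ⊕g H).Adj
  | .inl a, .inl b => inferInstanceAs (Decidable (G.Adj a b))
  | .inr a, .inr b => inferInstanceAs (Decidable (H.Adj a b))
  | .inl _, .inr _ => isFalse (by simp)
  | .inr _, .inl _ => isFalse (by simp)

end CliqueBehavior

theorem mainTheorem5 :
    (∀ (V : Type u) [Fintype V] (G : SimpleGraph V) [DecidableRel G.Adj],
      G.IsRegularOfDegree 2 →
        (CliqueBehavior.IsConvergent Gᶜ ↔ CliqueBehavior.IsHelly Gᶜ)) ∧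
    CliqueBehavior.IsHelly (SimpleGraph.cycleGraph 3 ⊕g SimpleGraph.cycleGraph 3)ᶜ ∧
    CliqueBehavior.IsHelly (SimpleGraph.cycleGraph 3 ⊕g SimpleGraph.cycleGraph 4)ᶜ ∧
    CliqueBehavior.IsHelly (SimpleGraph.cycleGraph 4 ⊕g SimpleGraph.cycleGraph 4)ᶜ ∧
    CliqueBehavior.IsDivergent (SimpleGraph.cycleGraph 8)ᶜ ∧
    CliqueBehavior.IsDivergent (SimpleGraph.cycleGraph 3 ⊕g SimpleGraph.cycleGraph 5)ᶜ := by
  have e33 : (CliqueBehavior.pairFlow 3 3).graph ≃g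
      (SimpleGraph.cycleGraph 3 ⊕g SimpleGraph.cycleGraph 3) :=
    -- `ZMod 3` is `Fin 3` by definition, so the identity serves as the isomorphism; likewise below.
    ⟨Equiv.refl _, by intro a b; revert a b; decide +kernel⟩
  have e34 : (CliqueBehavior.pairFlow 3 4).graph ≃g
      (SimpleGraph.cycleGraph 3 ⊕g SimpleGraph.cycleGraph 4) :=
    ⟨Equiv.refl _, by intro a b; revert a b; decide +kernel⟩
  have e44 : (CliqueBehavior.pairFlow 4 4).graph ≃g
      (SimpleGraph.cycleGraph 4 ⊕g SimpleGraph.cycleGraph 4) :=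
    ⟨Equiv.refl _, by intro a b; revert a b; decide +kernel⟩
  have e8 : (CliqueBehavior.cycleFlow 8).graph ≃g SimpleGraph.cycleGraph 8 :=
    ⟨Equiv.refl _, by intro a b; revert a b; decide +kernel⟩
  have e35 : (CliqueBehavior.pairFlow 3 5).graph ≃g
      (SimpleGraph.cycleGraph 3 ⊕g SimpleGraph.cycleGraph 5) :=
    ⟨Equiv.refl _, by intro a b; revert a b; decide +kernel⟩
  refine ⟨fun V _ G _ hG => CliqueBehavior.isConvergent_compl_iff_isHelly hG,
    (CliqueBehavior.pair_three_three_hellyCriterion.of_iso e33).isHelly,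
    (CliqueBehavior.pair_three_four_hellyCriterion.of_iso e34).isHelly,
    (CliqueBehavior.pair_four_four_hellyCriterion.of_iso e44).isHelly, fun h => ?_, fun h => ?_⟩
  · exact CliqueBehavior.cycle_not_isBounded le_rfl
      ((CliqueBehavior.isRetract_compl_of_iso e8).isBounded h.isBounded)
  · exact CliqueBehavior.pair_three_five_not_isBounded
      ((CliqueBehavior.isRetract_compl_of_iso e35).isBounded h.isBounded)
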